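/- Let $\hat H$ be a finitely presented right-orderable group, let $F_m$ be the free group on $m$ free generators, and let $\varepsilon : F_m \to \hat H$ be a surjective homomorphism. Let $T = \langle t^{\hat h} \mid \hat h \in \hat H\rangle$ be the free group with free generators $t^{\hat h}$ indexed by the elements $\hat h$ of $\hat H$, and let $T \rtimes F_m$ be the semidirect product in which $F_m$ acts on $T$ through the automorphisms determined by $$(t^{\hat h})^f = f^{-1}\, t^{\hat h} f = t^{\hat h\,\varepsilon(f)} \qquad (\hat h \in \hat H,\ f \in F_m).$$ Then $T \rtimes F_m$ embeds in a finitely presented (two-sided) orderable group; that is, there are a finitely presented group $G$ admitting a total order invariant under both left and right multiplication, and an injective homomorphism $T \rtimes F_m \to G$. (A group is right-orderable if it admits a total order $<$ such that $f<g$ implies $fx<gx$ for all elements $f,g,x$.) -/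

import Mathlib

/-- A group is right-orderable if it carries a total order `<` such that `f < g` implies
`f * x < g * x` for all `x`. -/
def RightOrderable (G : Type*) [Group G] : Prop :=
  ∃ o : LinearOrder G, ∀ f g x : G, o.lt f g → o.lt (f * x) (g * x)

/-- A group is (two-sided) orderable if it carries a total order `<` such that `f < g` implies
both `f * x < g * x` and `x * f < x * g` for all `x`. -/
def TwoSidedOrderable (G : Type*) [Group G] : Prop :=
  ∃ o : LinearOrder G, ∀ f g x : G, o.lt f g → o.lt (f * x) (g * x) ∧ o.lt (x * f) (x * g)

/-- The action of `F` on the free group with free generators `t ^ h` (`h : H`) by right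
multiplication of the exponents through `ε : F →* H`. In Mathlib's semidirect products `f` acts
as conjugation `n ↦ f * n * f⁻¹`, whereas `(t ^ h) ^ f` denotes `f⁻¹ * t ^ h * f`; so the rule
`(t ^ h) ^ f = t ^ (h * ε f)` means that `f` sends `t ^ h` to `t ^ (h * (ε f)⁻¹)`
(see `rightMulAction_conj`). -/
def rightMulAction {F H : Type*} [Group F] [Group H] (ε : F →* H) :
    F →* MulAut (FreeGroup H) where
  toFun f := FreeGroup.freeGroupCongr (Equiv.mulRight (ε f)⁻¹)
  map_one' := by
    ext x
    simp
  map_mul' f g := by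
    apply MulEquiv.ext
    intro x
    simp only [MulAut.mul_apply, FreeGroup.freeGroupCongr_apply, FreeGroup.map.comp]
    congr 2
    funext h
    simp [mul_assoc]

theorem rightMulAction_conj {F H : Type*} [Group F] [Group H] (ε : F →* H) (h : H) (f : F) :
    (SemidirectProduct.inr f)⁻¹ * SemidirectProduct.inl (FreeGroup.of h) * SemidirectProduct.inr f
      = (SemidirectProduct.inl (FreeGroup.of (h * ε f)) :
          FreeGroup H ⋊[rightMulAction ε] F) := by
  apply SemidirectProduct.ext
  · simp only [SemidirectProduct.mul_left, SemidirectProduct.inv_left, SemidirectProduct.inv_right,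
      SemidirectProduct.mul_right, SemidirectProduct.left_inr, SemidirectProduct.right_inr,
      SemidirectProduct.left_inl, SemidirectProduct.right_inl]
    simp [rightMulAction]
  · simp only [SemidirectProduct.mul_right, SemidirectProduct.inv_right,
      SemidirectProduct.right_inr, SemidirectProduct.right_inl]
    simp

/-! ### The Magnus representation of a free group and Fox decompositions. -/

section Magnus

open scoped Classical

/-! Enlarge `T` to the free group on letters `(n, c, h)`: one copy of `H` for each layer `(n, c)` in
`ℤ × Bool`. Three groups act on it and commute with one another: `F_m` by right translation of `h`,
`ℤ` by shifting `n`, and a free group of transvections. A transvection multiplies every letter of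
one color by a letter of the next lower layer, whose position is multiplied on the left by an
element of `H`. The semidirect product `LayeredGroup ε` contains `T ⋊ F_m` in the layer `(0,
false)`.

It is finitely presented. A priori infinitely many relations are needed, saying that `ker ε`
centralizes all letters. But if a relator `r` commutes with a letter `a` and with a transvection
`y`, then it commutes with `a⁻¹ (y a y⁻¹)`, a letter one layer lower at a neighbouring position, and
the shift, which also commutes with `r`, leads back up. So commutation with the two base letters
spreads to all letters (`commute_step`, `commute_relator`). With a single color, `l ↦ l * lower l`
would not be invertible; with two, the lowered letter is fixed.

It is orderable. In the Magnus order, `g` is positive if the coefficient of `g - 1` at the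
lexicographically largest word of its lowest degree is positive. This cone is preserved by every map
sending each letter `x` to `π x` up to smaller letters and higher degree, with `π` strictly monotone
(`IsUnitriangular.magnusPos_map`). Right translations are such maps because `H` is right-ordered.
Left multiplication need not be monotone, but it occurs only together with a drop to a lower layer.
Hence the cone extends lexicographically to the semidirect product
(`exists_isPositiveCone_layeredGroup`). -/

/-- Left multiplication by the letter `x` on noncommutative power series, a series being the
function of its coefficients. -/
noncomputable def letterMul {X : Type*} (x : X) : Module.End ℤ (List X → ℤ) where
  toFun φ
    | [] => 0
    | y :: w => if y = x then φ w else 0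
  map_add' φ ψ := by
    funext w
    cases w with
    | nil => simp
    | cons y w => by_cases h : y = x <;> simp [h]
  map_smul' a φ := by
    funext w
    cases w with
    | nil => simp
    | cons y w => by_cases h : y = x <;> simp [h]

@[simp] theorem letterMul_nil {X : Type*} (x : X) (φ : List X → ℤ) : letterMul x φ [] = 0 := rfl

theorem letterMul_cons {X : Type*} (x y : X) (w : List X) (φ : List X → ℤ) :
    letterMul x φ (y :: w) = if y = x then φ w else 0 := rfl

/-- The coefficients of `(1 + x)⁻¹ * φ`. -/
noncomputable def magnusInvFun {X : Type*} (x : X) (φ : List X → ℤ) : List X → ℤ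
  | [] => φ []
  | y :: w => φ (y :: w) - if y = x then magnusInvFun x φ w else 0

/-- Left multiplication by `1 + x` on noncommutative power series. -/
noncomputable def magnusGen {X : Type*} (x : X) : (List X → ℤ) ≃ₗ[ℤ] (List X → ℤ) :=
  LinearEquiv.ofBijective (1 + letterMul x) (by
    constructor
    · rw [injective_iff_map_eq_zero]
      intro φ hφ
      funext w
      induction w with
      | nil => simpa using congrFun hφ []
      | cons y w ih =>
        have := congrFun hφ (y :: w)
        simpa [letterMul_cons, ih] using this
    · intro φ
      refine ⟨magnusInvFun x φ, ?_⟩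
      funext w
      cases w with
      | nil => simp [magnusInvFun]
      | cons y w => by_cases h : y = x <;> simp [magnusInvFun, letterMul_cons, h])

theorem magnusGen_apply {X : Type*} (x : X) (φ : List X → ℤ) :
    magnusGen x φ = φ + letterMul x φ := rfl

/-- The action of the free group on noncommutative power series through the Magnus embedding. -/
noncomputable def magnusRep (X : Type*) : FreeGroup X →* Module.End ℤ (List X → ℤ) :=
  (LinearEquiv.automorphismGroup.toLinearMapMonoidHom).comp (FreeGroup.lift magnusGen)

theorem magnusRep_of {X : Type*} (x : X) (φ : List X → ℤ) :
    magnusRep X (FreeGroup.of x) φ = φ + letterMul x φ := by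
  simp [magnusRep, magnusGen_apply]

/-- The action of the group ring of the free group on noncommutative power series. -/
noncomputable def magnusAlg (X : Type*) :
    MonoidAlgebra ℤ (FreeGroup X) →ₐ[ℤ] Module.End ℤ (List X → ℤ) :=
  MonoidAlgebra.lift ℤ _ _ (magnusRep X)

/-- The coefficient of the word `w` in the Magnus expansion. -/
noncomputable def magnusCoeff {X : Type*} (α : MonoidAlgebra ℤ (FreeGroup X)) (w : List X) : ℤ :=
  magnusAlg X α (Pi.single [] 1) w

variable {X : Type*}

local notation "ℤF" => MonoidAlgebra ℤ (FreeGroup X)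

/-- A group element, as an element of the group ring. -/
noncomputable abbrev ofG (g : FreeGroup X) : MonoidAlgebra ℤ (FreeGroup X) :=
  MonoidAlgebra.of ℤ (FreeGroup X) g

theorem magnusAlg_of (g : FreeGroup X) : magnusAlg X (ofG g) = magnusRep X g := by
  simp [magnusAlg, ofG]

theorem magnusCoeff_add (α β : ℤF) (w : List X) :
    magnusCoeff (α + β) w = magnusCoeff α w + magnusCoeff β w := by
  simp [magnusCoeff]

theorem magnusCoeff_sub (α β : ℤF) (w : List X) :
    magnusCoeff (α - β) w = magnusCoeff α w - magnusCoeff β w := by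
  simp [magnusCoeff]

theorem magnusCoeff_neg (α : ℤF) (w : List X) :
    magnusCoeff (-α) w = -magnusCoeff α w := by
  simp [magnusCoeff]

theorem magnusCoeff_zero (w : List X) : magnusCoeff (0 : ℤF) w = 0 := by
  simp [magnusCoeff]

theorem magnusCoeff_sum {ι : Type*} (s : Finset ι) (f : ι → ℤF) (w : List X) :
    magnusCoeff (∑ i ∈ s, f i) w = ∑ i ∈ s, magnusCoeff (f i) w := by
  simp [magnusCoeff]

theorem magnusCoeff_smul (k : ℤ) (α : ℤF) (w : List X) :
    magnusCoeff (k • α) w = k * magnusCoeff α w := by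
  simp [magnusCoeff]

theorem magnusCoeff_one (w : List X) :
    magnusCoeff (1 : ℤF) w = if w = [] then 1 else 0 := by
  simp [magnusCoeff, Pi.single_apply]

theorem magnusCoeff_genMul_nil (x : X) (α : ℤF) :
    magnusCoeff ((ofG (FreeGroup.of x) - 1) * α) [] = 0 := by
  simp [magnusCoeff, magnusAlg_of, magnusRep_of, -MonoidAlgebra.of_apply]

/-- The Magnus expansion of `x - 1` is the letter `x` itself, so multiplying by it only prepends a
letter to words. -/
theorem magnusCoeff_genMul_cons (x y : X) (α : ℤF) (w : List X) :
    magnusCoeff ((ofG (FreeGroup.of x) - 1) * α) (y :: w) =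
      if y = x then magnusCoeff α w else 0 := by
  simp [magnusCoeff, magnusAlg_of, magnusRep_of, letterMul_cons, -MonoidAlgebra.of_apply]

/-- Every element of the group ring is a constant plus a combination of the `x - 1`. -/
theorem exists_fox_decomposition (α : ℤF) :
    ∃ (k : ℤ) (s : Finset X) (γ : X → ℤF), (∀ x ∉ s, γ x = 0) ∧
      α = k • 1 + ∑ x ∈ s, (ofG (FreeGroup.of x) - 1) * γ x := by
  -- Decomposable elements form a subgroup, so group elements suffice. For inverses use `x⁻¹ = 1 -
  -- (x - 1) x⁻¹`; for `g h`, expand `g` and keep `h` as a right factor.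
  let S : AddSubgroup ℤF :=
    { carrier := {α | ∃ (k : ℤ) (s : Finset X) (γ : X → ℤF), (∀ x ∉ s, γ x = 0) ∧
        α = k • 1 + ∑ x ∈ s, (ofG (FreeGroup.of x) - 1) * γ x}
      zero_mem' := ⟨0, ∅, 0, by simp, by simp⟩
      add_mem' := by
        rintro _ _ ⟨k, s, γ, hγ, rfl⟩ ⟨k', s', γ', hγ', rfl⟩
        refine ⟨k + k', s ∪ s', γ + γ', ?_, ?_⟩
        · intro x hx
          simp only [Finset.mem_union, not_or] at hx
          simp [hγ x hx.1, hγ' x hx.2]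
        · have h1 : ∑ x ∈ s, (ofG (FreeGroup.of x) - 1) * γ x =
              ∑ x ∈ s ∪ s', (ofG (FreeGroup.of x) - 1) * γ x :=
            Finset.sum_subset Finset.subset_union_left
              (fun x _ hx => by rw [hγ x hx, mul_zero])
          have h2 : ∑ x ∈ s', (ofG (FreeGroup.of x) - 1) * γ' x =
              ∑ x ∈ s ∪ s', (ofG (FreeGroup.of x) - 1) * γ' x :=
            Finset.sum_subset Finset.subset_union_right
              (fun x _ hx => by rw [hγ' x hx, mul_zero])
          rw [h1, h2]
          simp only [Pi.add_apply, mul_add, Finset.sum_add_distrib, add_smul]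
          abel
      neg_mem' := by
        rintro _ ⟨k, s, γ, hγ, rfl⟩
        refine ⟨-k, s, -γ, fun x hx => by simp [hγ x hx], ?_⟩
        simp [add_comm] }
  have hgen : ∀ (x : X) (β : ℤF), (ofG (FreeGroup.of x) - 1) * β ∈ S := fun x β =>
    ⟨0, {x}, Pi.single x β, fun y hy => by
      simp only [Finset.mem_singleton] at hy; simp [hy], by simp⟩
  have hone : (1 : ℤF) ∈ S := ⟨1, ∅, 0, by simp, by simp⟩
  have hof : ∀ g : FreeGroup X, ofG g ∈ S := by
    intro g
    induction g using FreeGroup.induction_on with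
    | C1 => rw [ofG, map_one]; exact hone
    | of x =>
      have := S.add_mem (hgen x 1) hone
      simpa using this
    | inv_of x _ =>
      have := S.sub_mem hone (hgen x (ofG (FreeGroup.of x)⁻¹))
      have e : (1 : ℤF) - (ofG (FreeGroup.of x) - 1) * ofG (FreeGroup.of x)⁻¹ =
          ofG (FreeGroup.of x)⁻¹ := by
        rw [sub_mul, ← map_mul, mul_inv_cancel, map_one, one_mul]
        abel
      rwa [e] at this
    | mul g h hg hh =>
      obtain ⟨k, s, γ, -, e⟩ := hg
      rw [ofG, map_mul, show MonoidAlgebra.of ℤ (FreeGroup X) g = _ from e, add_mul,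
        Finset.sum_mul]
      refine S.add_mem ?_ (S.sum_mem fun x _ => ?_)
      · rw [smul_mul_assoc, one_mul]
        exact S.zsmul_mem hh k
      · rw [mul_assoc]
        exact hgen _ _
  change α ∈ S
  induction α using MonoidAlgebra.induction_on with
  | of g => exact hof g
  | add f g hf hg => exact S.add_mem hf hg
  | smul r f hf => exact S.zsmul_mem hf r

end Magnus

/-! ### The filtration by order of the Magnus expansion, and its leading coefficients. -/

section MagnusFiltration

open scoped Classical

variable {X : Type*}

local notation "ℤF" => MonoidAlgebra ℤ (FreeGroup X)

theorem magnusCoeff_fox_nil (k : ℤ) (s : Finset X) (γ : X → ℤF) :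
    magnusCoeff (k • 1 + ∑ x ∈ s, (ofG (FreeGroup.of x) - 1) * γ x) [] = k := by
  rw [magnusCoeff_add, magnusCoeff_smul, magnusCoeff_one, magnusCoeff_sum]
  simp only [magnusCoeff_genMul_nil]
  simp

theorem magnusCoeff_fox_cons {k : ℤ} {s : Finset X} {γ : X → ℤF} (hγ : ∀ x ∉ s, γ x = 0)
    (y : X) (w : List X) :
    magnusCoeff (k • 1 + ∑ x ∈ s, (ofG (FreeGroup.of x) - 1) * γ x) (y :: w) =
      magnusCoeff (γ y) w := by
  rw [magnusCoeff_add, magnusCoeff_smul, magnusCoeff_one, magnusCoeff_sum]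
  simp only [magnusCoeff_genMul_cons, Finset.sum_ite_eq]
  by_cases hy : y ∈ s
  · simp [hy]
  · simp [hy, hγ y hy, magnusCoeff_zero]

/-- The powers of the augmentation ideal, described by vanishing of Magnus coefficients. -/
def magnusIdeal (X : Type*) (n : ℕ) : AddSubgroup (MonoidAlgebra ℤ (FreeGroup X)) where
  carrier := {α | ∀ w : List X, w.length < n → magnusCoeff α w = 0}
  zero_mem' w _ := magnusCoeff_zero w
  add_mem' {α β} hα hβ w hw := by rw [magnusCoeff_add, hα w hw, hβ w hw, add_zero]
  neg_mem' {α} hα w hw := by rw [magnusCoeff_neg, hα w hw, neg_zero]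

theorem magnusIdeal_anti {n m : ℕ} (h : n ≤ m) : magnusIdeal X m ≤ magnusIdeal X n :=
  fun _ hα w hw => hα w (hw.trans_le h)

/-- An element of a positive power of the augmentation ideal is a combination of the `x - 1` with
coefficients in the preceding power. -/
theorem exists_fox_of_mem {n : ℕ} {α : ℤF} (hα : α ∈ magnusIdeal X (n + 1)) :
    ∃ (s : Finset X) (γ : X → ℤF), (∀ x, γ x ∈ magnusIdeal X n) ∧
      (∀ y w, magnusCoeff α (y :: w) = magnusCoeff (γ y) w) ∧ (∀ x ∉ s, γ x = 0) ∧
      α = ∑ x ∈ s, (ofG (FreeGroup.of x) - 1) * γ x := by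
  obtain ⟨k, s, γ, hγ, e⟩ := exists_fox_decomposition α
  have hk : k = 0 := by
    rw [← magnusCoeff_fox_nil k s γ, ← e]
    exact hα [] (by simp)
  have hc : ∀ y w, magnusCoeff α (y :: w) = magnusCoeff (γ y) w := fun y w => by
    rw [e, magnusCoeff_fox_cons hγ]
  refine ⟨s, γ, fun x w hw => ?_, hc, hγ, by rw [e, hk, zero_smul, zero_add]⟩
  rw [← hc]
  exact hα _ (by simpa using hw)

/-- Since `β` has no terms below degree `n`, only the constant term of `γ` contributes in degrees up
to `n`. Expanding `γ` strips one letter of the word at a time. -/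
theorem magnusCoeff_mul_left {n : ℕ} {β : ℤF} (hβ : β ∈ magnusIdeal X n) (w : List X) :
    ∀ γ : ℤF, w.length ≤ n → magnusCoeff (γ * β) w = magnusCoeff γ [] * magnusCoeff β w := by
  induction w with
  | nil =>
    intro γ _
    obtain ⟨k, s, δ, hδ, rfl⟩ := exists_fox_decomposition γ
    rw [magnusCoeff_fox_nil, add_mul, Finset.sum_mul, magnusCoeff_add, magnusCoeff_sum,
      smul_mul_assoc, one_mul, magnusCoeff_smul]
    simp only [mul_assoc, magnusCoeff_genMul_nil]
    simp
  | cons y w ih =>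
    intro γ hw
    simp only [List.length_cons] at hw
    obtain ⟨k, s, δ, hδ, rfl⟩ := exists_fox_decomposition γ
    rw [magnusCoeff_fox_nil, add_mul, Finset.sum_mul, smul_mul_assoc, one_mul, magnusCoeff_add,
      magnusCoeff_smul, magnusCoeff_sum]
    simp only [mul_assoc, magnusCoeff_genMul_cons, Finset.sum_ite_eq]
    rw [ih (δ y) (by omega), hβ w (by omega)]
    simp

theorem magnusCoeff_mul_right (γ : ℤF) {n : ℕ} (w : List X) :
    ∀ {α : ℤF}, α ∈ magnusIdeal X n → w.length ≤ n →
      magnusCoeff (α * γ) w = magnusCoeff α w * magnusCoeff γ [] := by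
  induction w generalizing n with
  | nil =>
    intro α _ _
    exact magnusCoeff_mul_left (n := 0) (fun w hw => by simp at hw) [] α (by simp)
  | cons y w ih =>
    intro α hα hw
    obtain ⟨n, rfl⟩ : ∃ k, n = k + 1 := ⟨n - 1, by simp at hw; omega⟩
    obtain ⟨s, δ, hδ, hc, hs, e⟩ := exists_fox_of_mem hα
    rw [hc, ← ih (hδ y) (by simpa using hw), e, Finset.sum_mul, magnusCoeff_sum]
    simp only [mul_assoc, magnusCoeff_genMul_cons, Finset.sum_ite_eq]
    by_cases hy : y ∈ s
    · simp [hy]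
    · simp [hy, hs y hy, magnusCoeff_zero]

/-- Leading coefficients are multiplicative. -/
theorem magnusCoeff_mul_cons {n : ℕ} {α β : ℤF} (hα : α ∈ magnusIdeal X 1)
    (hβ : β ∈ magnusIdeal X n) (x : X) (w : List X) (hw : w.length ≤ n) :
    magnusCoeff (α * β) (x :: w) = magnusCoeff α [x] * magnusCoeff β w := by
  obtain ⟨s, δ, -, hc, hs, e⟩ := exists_fox_of_mem hα
  rw [hc, ← magnusCoeff_mul_left hβ w _ hw, e, Finset.sum_mul, magnusCoeff_sum]
  simp only [mul_assoc, magnusCoeff_genMul_cons, Finset.sum_ite_eq]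
  by_cases hy : x ∈ s
  · simp [hy]
  · simp [hy, hs x hy, magnusCoeff_zero]

theorem mul_mem_magnusIdeal_succ {n : ℕ} {α β : ℤF} (hα : α ∈ magnusIdeal X 1)
    (hβ : β ∈ magnusIdeal X n) : α * β ∈ magnusIdeal X (n + 1) := by
  intro w hw
  cases w with
  | nil =>
    rw [magnusCoeff_mul_left hβ _ _ (by simp), hα [] (by simp), zero_mul]
  | cons x w =>
    simp only [List.length_cons, add_lt_add_iff_right] at hw
    rw [magnusCoeff_mul_cons hα hβ x w hw.le, hβ w hw, mul_zero]

theorem magnusCoeff_ofG_nil (g : FreeGroup X) : magnusCoeff (ofG g) [] = 1 := by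
  have hmul : ∀ g h : FreeGroup X,
      magnusCoeff (ofG (g * h)) [] = magnusCoeff (ofG g) [] * magnusCoeff (ofG h) [] :=
    fun g h => by
      rw [ofG, map_mul]
      exact magnusCoeff_mul_left (n := 0) (fun w hw => by simp at hw) [] _ (by simp)
  have hone : magnusCoeff (ofG (1 : FreeGroup X)) [] = 1 := by
    rw [ofG, map_one, magnusCoeff_one, if_pos rfl]
  have hof : ∀ x : X, magnusCoeff (ofG (FreeGroup.of x)) [] = 1 := fun x => by
    have := magnusCoeff_genMul_nil x (1 : ℤF)
    rw [mul_one, magnusCoeff_sub, magnusCoeff_one, if_pos rfl] at this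
    omega
  induction g using FreeGroup.induction_on with
  | C1 => exact hone
  | of x => exact hof x
  | inv_of x _ =>
    have := hmul (FreeGroup.of x) (FreeGroup.of x)⁻¹
    rw [mul_inv_cancel, hone, hof, one_mul] at this
    exact this.symm
  | mul g h hg hh => rw [hmul, hg, hh, one_mul]

theorem ofG_sub_one_mem (g : FreeGroup X) : ofG g - 1 ∈ magnusIdeal X 1 := by
  intro w hw
  obtain rfl : w = [] := by simpa using hw
  rw [magnusCoeff_sub, magnusCoeff_ofG_nil, magnusCoeff_one, if_pos rfl, sub_self]

/-- From `g h = (g - 1) h + h`: the linear part of the Magnus expansion is the abelianization. -/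
theorem magnusCoeff_ofG_mul_singleton (g h : FreeGroup X) (x : X) :
    magnusCoeff (ofG (g * h)) [x] = magnusCoeff (ofG g) [x] + magnusCoeff (ofG h) [x] := by
  have e : ofG (g * h) = (ofG g - 1) * ofG h + ofG h := by
    rw [ofG, map_mul, sub_mul, one_mul, sub_add_cancel]
  rw [e, magnusCoeff_add, magnusCoeff_mul_right _ _ (ofG_sub_one_mem g) (by simp),
    magnusCoeff_ofG_nil, magnusCoeff_sub, magnusCoeff_one]
  simp

theorem magnusCoeff_ofG_of_singleton (x y : X) :
    magnusCoeff (ofG (FreeGroup.of x)) [y] = if y = x then 1 else 0 := by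
  have := magnusCoeff_genMul_cons x y (1 : ℤF) []
  rw [mul_one, magnusCoeff_sub, magnusCoeff_one, magnusCoeff_one] at this
  simpa using this

/-- Only finitely many coefficients of each degree are nonzero. -/
theorem finite_magnusCoeff (n : ℕ) :
    ∀ α : ℤF, {w : List X | w.length = n ∧ magnusCoeff α w ≠ 0}.Finite := by
  induction n with
  | zero =>
    intro α
    refine (Set.finite_singleton []).subset ?_
    rintro w ⟨hw, -⟩
    simpa using hw
  | succ n ih =>
    intro α
    obtain ⟨k, s, γ, hγ, rfl⟩ := exists_fox_decomposition α
    refine (s.finite_toSet.biUnion fun x _ => (ih (γ x)).image (List.cons x)).subset ?_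
    rintro w ⟨hw, hne⟩
    cases w with
    | nil => simp at hw
    | cons x w =>
      rw [magnusCoeff_fox_cons hγ] at hne
      have hx : x ∈ s := by
        by_contra hx
        exact hne (by rw [hγ x hx, magnusCoeff_zero])
      exact Set.mem_biUnion hx ⟨w, ⟨by simpa using hw, hne⟩, rfl⟩

end MagnusFiltration

/-! ### Faithfulness of the Magnus expansion. -/

section MagnusInjective

open scoped Classical

variable {X : Type*}

/-- Every element of a free group is a product of nontrivial powers of letters, adjacent letters
being distinct. -/
theorem exists_syllables (g : FreeGroup X) :
    ∃ l : List (X × ℤ), (∀ p ∈ l, p.2 ≠ 0) ∧ (l.map Prod.fst).IsChain (· ≠ ·) ∧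
      g = (l.map fun p => FreeGroup.of p.1 ^ p.2).prod := by
  -- A syllable multiplied on the left is prepended, merges with a first syllable in the same
  -- letter, or cancels against it.
  have key : ∀ (x : X) (e : ℤ) (g : FreeGroup X), e ≠ 0 →
      (∃ l : List (X × ℤ), (∀ p ∈ l, p.2 ≠ 0) ∧ (l.map Prod.fst).IsChain (· ≠ ·) ∧
        g = (l.map fun p => FreeGroup.of p.1 ^ p.2).prod) →
      (∃ l : List (X × ℤ), (∀ p ∈ l, p.2 ≠ 0) ∧ (l.map Prod.fst).IsChain (· ≠ ·) ∧
        FreeGroup.of x ^ e * g = (l.map fun p => FreeGroup.of p.1 ^ p.2).prod) := by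
    rintro x e _ he ⟨l, hl, hc, rfl⟩
    cases l with
    | nil => exact ⟨[(x, e)], by simpa using he, by simp, by simp⟩
    | cons p l =>
      obtain ⟨y, f⟩ := p
      by_cases hxy : x = y
      · subst hxy
        by_cases hef : e + f = 0
        · refine ⟨l, fun p hp => hl p (by simp [hp]), ?_, ?_⟩
          · exact List.IsChain.tail hc
          · simp [← mul_assoc, ← zpow_add, hef]
        · refine ⟨(x, e + f) :: l, ?_, hc, ?_⟩
          · intro p hp
            rcases List.mem_cons.1 hp with rfl | hp
            · exact hef
            · exact hl p (by simp [hp])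
          · simp [← mul_assoc, ← zpow_add]
      · refine ⟨(x, e) :: (y, f) :: l, ?_, ?_, by simp⟩
        · intro p hp
          rcases List.mem_cons.1 hp with rfl | hp
          · exact he
          · exact hl p hp
        · simp only [List.map_cons] at hc ⊢
          exact List.isChain_cons_cons.2 ⟨hxy, hc⟩
  suffices h : ∀ g h : FreeGroup X,
      (∃ l : List (X × ℤ), (∀ p ∈ l, p.2 ≠ 0) ∧ (l.map Prod.fst).IsChain (· ≠ ·) ∧
        h = (l.map fun p => FreeGroup.of p.1 ^ p.2).prod) →
      (∃ l : List (X × ℤ), (∀ p ∈ l, p.2 ≠ 0) ∧ (l.map Prod.fst).IsChain (· ≠ ·) ∧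
        g * h = (l.map fun p => FreeGroup.of p.1 ^ p.2).prod) by
    simpa using h g 1 ⟨[], by simp, by simp, by simp⟩
  intro g
  induction g using FreeGroup.induction_on with
  | C1 => intro h hh; simpa using hh
  | of x => intro h hh; simpa using key x 1 h (by simp) hh
  | inv_of x _ => intro h hh; simpa using key x (-1) h (by simp) hh
  | mul a b ha hb => intro h hh; rw [mul_assoc]; exact ha _ (hb _ hh)

/-- `(1 + x) ^ e` is `1 + e x` plus terms divisible by `x²`, and those only produce words starting
with `x x`, which the chain condition excludes. -/
theorem magnusRep_zpow_apply (x : X) (e : ℤ) (φ : List X → ℤ) (y : X) (w : List X)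
    (hw : (y :: w).IsChain (· ≠ ·)) :
    magnusRep X (FreeGroup.of x ^ e) φ (y :: w) = φ (y :: w) + if y = x then e * φ w else 0 := by
  -- The word `w` does not begin with `y`, so powers of `1 + y` leave the coefficient at `w`
  -- unchanged.
  have htail : ∀ e : ℤ, y = x →
      magnusRep X (FreeGroup.of x ^ e) φ w = φ w := by
    rintro e rfl
    have hof : ∀ ψ : List X → ℤ, magnusRep X (FreeGroup.of y) ψ w = ψ w := by
      intro ψ
      rw [magnusRep_of]
      cases w with
      | nil => simp
      | cons z w =>
        have : y ≠ z := (List.isChain_cons_cons.1 hw).1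
        simp [letterMul_cons, this.symm]
    induction e using Int.induction_on with
    | zero => simp
    | succ n ih => rw [add_comm, zpow_add, map_mul, Module.End.mul_apply, zpow_one, hof, ih]
    | pred n ih =>
      rw [← hof (magnusRep X (FreeGroup.of y ^ (-(n : ℤ) - 1)) φ), ← Module.End.mul_apply,
        ← map_mul, ← zpow_one_add, add_sub_cancel, ih]
  have hstep : ∀ e : ℤ, magnusRep X (FreeGroup.of x ^ (e + 1)) φ (y :: w) =
      magnusRep X (FreeGroup.of x ^ e) φ (y :: w) + if y = x then φ w else 0 := by
    intro e
    rw [add_comm, zpow_add, map_mul, Module.End.mul_apply, zpow_one, magnusRep_of, Pi.add_apply,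
      letterMul_cons]
    by_cases h : y = x
    · simp only [h, if_true, ← htail e h]
    · simp [h]
  induction e using Int.induction_on with
  | zero => simp
  | succ n ih =>
    rw [hstep, ih]
    split_ifs <;> ring
  | pred n ih =>
    have := hstep (-n - 1)
    rw [sub_add_cancel, ih] at this
    split_ifs at this ⊢ <;> linarith

/-- The Magnus coefficient of a reduced word at its own sequence of letters. -/
theorem magnusRep_syllables (l : List (X × ℤ)) (hc : (l.map Prod.fst).IsChain (· ≠ ·)) :
    (∀ w : List X, w.IsChain (· ≠ ·) → l.length < w.length →
      magnusRep X (l.map fun p => FreeGroup.of p.1 ^ p.2).prod (Pi.single [] 1) w = 0) ∧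
    magnusRep X (l.map fun p => FreeGroup.of p.1 ^ p.2).prod (Pi.single [] 1) (l.map Prod.fst) =
      (l.map Prod.snd).prod := by
  induction l with
  | nil =>
    refine ⟨fun w _ hw => ?_, by simp⟩
    have : w ≠ [] := by rintro rfl; simp at hw
    simp [this]
  | cons p l ih =>
    obtain ⟨h1, h2⟩ := ih (List.IsChain.tail hc)
    constructor
    · intro w hw hlen
      cases w with
      | nil => simp at hlen
      | cons y w =>
        simp only [List.length_cons, add_lt_add_iff_right] at hlen
        rw [List.map_cons, List.prod_cons, map_mul, Module.End.mul_apply,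
          magnusRep_zpow_apply _ _ _ _ _ hw, h1 _ hw (by simp; omega),
          h1 w (List.IsChain.tail hw) hlen]
        simp
    -- The coefficient of the remaining product at the full word vanishes, that word being too long;
    -- only the exponent times the coefficient at the tail is left.
    · rw [List.map_cons] at hc
      rw [List.map_cons, List.prod_cons, map_mul, Module.End.mul_apply, List.map_cons,
        magnusRep_zpow_apply _ _ _ _ _ hc, h1 _ hc (by simp), h2]
      simp

/-- Magnus' theorem: a nontrivial element has a nontrivial Magnus expansion. -/
theorem exists_magnusCoeff_ne_zero {g : FreeGroup X} (hg : g ≠ 1) :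
    ∃ w : List X, w ≠ [] ∧ magnusCoeff (ofG g) w ≠ 0 := by
  obtain ⟨l, hl, hc, rfl⟩ := exists_syllables g
  refine ⟨l.map Prod.fst, ?_, ?_⟩
  · rintro h
    rw [List.map_eq_nil_iff] at h
    subst h
    simp at hg
  · rw [magnusCoeff, magnusAlg_of, (magnusRep_syllables l hc).2]
    intro h
    rw [List.prod_eq_zero_iff, List.mem_map] at h
    obtain ⟨p, hp, h0⟩ := h
    exact hl p hp h0

end MagnusInjective

/-! ### Positive cones and lexicographic extensions. -/

section Cones

/-- `P` is the set of positive elements of a two-sided order. -/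
structure IsPositiveCone {G : Type*} [Group G] (P : G → Prop) : Prop where
  mul : ∀ {a b}, P a → P b → P (a * b)
  conj : ∀ {a} (g : G), P a → P (g * a * g⁻¹)
  not_one : ¬ P 1
  total : ∀ a, a ≠ 1 → P a ∨ P a⁻¹

/-- With `a < b` meaning `P (a⁻¹ * b)`, left invariance is automatic and right invariance is
invariance of `P` under conjugation. -/
theorem IsPositiveCone.twoSidedOrderable {G : Type*} [Group G] {P : G → Prop}
    (hP : IsPositiveCone P) : TwoSidedOrderable G := by
  classical
  have htr : ∀ {a b c : G}, P (a⁻¹ * b) → P (b⁻¹ * c) → P (a⁻¹ * c) := fun h h' => by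
    simpa [mul_assoc] using hP.mul h h'
  have hasymm : ∀ {a b : G}, P (a⁻¹ * b) → ¬ P (b⁻¹ * a) := fun h h' =>
    hP.not_one (by simpa using htr h h')
  let o : LinearOrder G :=
    { le := fun a b => a = b ∨ P (a⁻¹ * b)
      lt := fun a b => P (a⁻¹ * b)
      le_refl := fun a => Or.inl rfl
      le_trans := by
        rintro a b c (rfl | h) (rfl | h')
        · exact Or.inl rfl
        · exact Or.inr h'
        · exact Or.inr h
        · exact Or.inr (htr h h')
      lt_iff_le_not_ge := by
        intro a b
        constructor
        · intro h
          refine ⟨Or.inr h, ?_⟩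
          rintro (rfl | h')
          · exact hP.not_one (by simpa using h)
          · exact hasymm h h'
        · rintro ⟨rfl | h, h'⟩
          · exact absurd (Or.inl rfl) h'
          · exact h
      le_antisymm := by
        rintro a b (rfl | h) (h' | h')
        · rfl
        · rfl
        · exact h'.symm
        · exact absurd h' (hasymm h)
      le_total := by
        intro a b
        by_cases hab : a = b
        · exact Or.inl (Or.inl hab)
        · rcases hP.total (a⁻¹ * b) (by rwa [ne_eq, inv_mul_eq_one]) with h | h
          · exact Or.inl (Or.inr h)
          · exact Or.inr (Or.inr (by simpa using h))
      toDecidableLE := Classical.decRel _ }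
  refine ⟨o, fun f g x h => ⟨?_, ?_⟩⟩
  · have := hP.conj x⁻¹ (show P (f⁻¹ * g) from h)
    change P ((f * x)⁻¹ * (g * x))
    simpa only [mul_inv_rev, mul_assoc, inv_inv] using this
  · change P ((x * f)⁻¹ * (x * g))
    rw [mul_inv_rev, mul_assoc, inv_mul_cancel_left]
    exact h

theorem IsPositiveCone.comap {G K : Type*} [Group G] [Group K] {P : G → Prop}
    (hP : IsPositiveCone P) (f : K →* G) (hf : Function.Injective f) :
    IsPositiveCone fun k => P (f k) where
  mul ha hb := by simpa using hP.mul ha hb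
  conj g ha := by simpa using hP.conj (f g) ha
  not_one := by simpa using hP.not_one
  total a ha := by simpa using hP.total (f a) (by simpa using (hf.ne ha))

/-- The quotient decides first. Invariance of `P` under the action is what conjugation of the kernel
by the quotient requires. -/
theorem IsPositiveCone.semidirectProduct {N Q : Type*} [Group N] [Group Q] {φ : Q →* MulAut N}
    {P : N → Prop} {P' : Q → Prop} (hP : IsPositiveCone P) (hP' : IsPositiveCone P')
    (hφ : ∀ q a, P a → P (φ q a)) :
    IsPositiveCone fun e : N ⋊[φ] Q => P' e.right ∨ e.right = 1 ∧ P e.left where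
  mul := by
    rintro ⟨a, q⟩ ⟨b, r⟩ (h | ⟨h1, h2⟩) (h' | ⟨h1', h2'⟩) <;> dsimp only at * <;>
      simp only [SemidirectProduct.mul_left, SemidirectProduct.mul_right]
    · exact Or.inl (hP'.mul h h')
    · subst h1'; exact Or.inl (by simpa using h)
    · subst h1; exact Or.inl (by simpa using h')
    · subst h1 h1'; exact Or.inr ⟨by simp, by simpa using hP.mul h2 h2'⟩
  conj := by
    rintro ⟨a, q⟩ g (h | ⟨h1, h2⟩)
    · exact Or.inl (by simpa using hP'.conj g.right h)
    · dsimp only at h1 h2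
      subst h1
      refine Or.inr ⟨by simp, ?_⟩
      simpa using hP.conj g.left (hφ g.right _ h2)
  not_one := by
    rintro (h | ⟨-, h⟩)
    · exact hP'.not_one (by simpa using h)
    · exact hP.not_one (by simpa using h)
  total := by
    rintro ⟨a, q⟩ hne
    by_cases hq : q = 1
    · subst hq
      have ha : a ≠ 1 := by rintro rfl; exact hne rfl
      rcases hP.total a ha with h | h
      · exact Or.inl (Or.inr ⟨rfl, h⟩)
      · exact Or.inr (Or.inr ⟨by simp, by simpa using h⟩)
    · rcases hP'.total q hq with h | h
      · exact Or.inl (Or.inl h)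
      · exact Or.inr (Or.inl (by simpa using h))

theorem IsPositiveCone.prod {G K : Type*} [Group G] [Group K] {P : G → Prop} {P' : K → Prop}
    (hP : IsPositiveCone P) (hP' : IsPositiveCone P') :
    ∃ P'' : G × K → Prop, IsPositiveCone P'' :=
  let e : G ⋊[1] K ≃* G × K := SemidirectProduct.mulEquivProd
  ⟨_, (hP.semidirectProduct (φ := 1) hP' fun _ _ h => h).comap e.symm.toMonoidHom
    e.symm.injective⟩

theorem isPositiveCone_int :
    IsPositiveCone fun k : Multiplicative ℤ => 0 < Multiplicative.toAdd k where
  mul ha hb := by simpa using add_pos ha hb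
  conj g ha := by simpa using ha
  not_one := by simp
  total a ha := by
    have : Multiplicative.toAdd a ≠ 0 := by simpa using ha
    simpa using lt_or_gt_of_ne this.symm

end Cones

/-! ### The Magnus order and its unitriangular endomorphisms. -/

section MagnusOrder

/-- An endomorphism of the free group, extended to the group ring. -/
noncomputable def groupRingMap {X : Type*} (q : FreeGroup X →* FreeGroup X) :
    MonoidAlgebra ℤ (FreeGroup X) →ₐ[ℤ] MonoidAlgebra ℤ (FreeGroup X) :=
  MonoidAlgebra.lift ℤ _ _ ((MonoidAlgebra.of ℤ (FreeGroup X)).comp q)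

theorem groupRingMap_ofG {X : Type*} (q : FreeGroup X →* FreeGroup X) (g : FreeGroup X) :
    groupRingMap q (ofG g) = ofG (q g) := by
  simp [groupRingMap, ofG]

/-- Elements of order `n + 1` are sums of `(x - 1) γ` with `γ` of order at least `n`, and the image
`q x - 1` again has zero constant term. -/
theorem groupRingMap_mem {X : Type*} {n : ℕ} (q : FreeGroup X →* FreeGroup X) :
    ∀ {α : MonoidAlgebra ℤ (FreeGroup X)}, α ∈ magnusIdeal X n → groupRingMap q α ∈ magnusIdeal X n := by
  induction n with
  | zero => intro α _ w hw; simp at hw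
  | succ n ih =>
    intro α hα
    obtain ⟨s, γ, hγ, -, -, rfl⟩ := exists_fox_of_mem hα
    rw [map_sum]
    refine sum_mem fun x _ => ?_
    rw [map_mul, map_sub, map_one, groupRingMap_ofG]
    exact mul_mem_magnusIdeal_succ (ofG_sub_one_mem _) (ih (hγ x))

variable {X : Type*} [LinearOrder X]

local notation "ℤF" => MonoidAlgebra ℤ (FreeGroup X)

/-- `α` has order `n`, and its coefficient at the largest word of length `n` is positive. -/
def LeadPos (n : ℕ) (α : MonoidAlgebra ℤ (FreeGroup X)) : Prop :=
  α ∈ magnusIdeal X n ∧ ∃ w : List X, w.length = n ∧ 0 < magnusCoeff α w ∧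
    ∀ v : List X, v.length = n → w < v → magnusCoeff α v = 0

theorem LeadPos.congr {n : ℕ} {α β : ℤF} (h : LeadPos n α) (hβ : β ∈ magnusIdeal X n)
    (e : ∀ w : List X, w.length = n → magnusCoeff β w = magnusCoeff α w) : LeadPos n β := by
  obtain ⟨-, w, hw, hpos, hmax⟩ := h
  exact ⟨hβ, w, hw, by rwa [e w hw], fun v hv hwv => by rw [e v hv, hmax v hv hwv]⟩

theorem LeadPos.add {n : ℕ} {α β : ℤF} (h : LeadPos n α) (h' : LeadPos n β) :
    LeadPos n (α + β) := by
  obtain ⟨hα, w, hw, hpos, hmax⟩ := h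
  obtain ⟨hβ, w', hw', hpos', hmax'⟩ := h'
  refine ⟨add_mem hα hβ, ?_⟩
  rcases lt_trichotomy w w' with hlt | rfl | hlt
  · refine ⟨w', hw', ?_, fun v hv hwv => ?_⟩
    · rw [magnusCoeff_add, hmax w' hw' hlt, zero_add]; exact hpos'
    · rw [magnusCoeff_add, hmax v hv (hlt.trans hwv), hmax' v hv hwv, add_zero]
  · refine ⟨w, hw, ?_, fun v hv hwv => ?_⟩
    · rw [magnusCoeff_add]; exact add_pos hpos hpos'
    · rw [magnusCoeff_add, hmax v hv hwv, hmax' v hv hwv, add_zero]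
  · refine ⟨w, hw, ?_, fun v hv hwv => ?_⟩
    · rw [magnusCoeff_add, hmax' w hw hlt, add_zero]; exact hpos
    · rw [magnusCoeff_add, hmax v hv hwv, hmax' v hv (hlt.trans hwv), add_zero]

/-- A largest word exists even over an infinite alphabet, because only finitely many words of each
length occur. -/
theorem leadPos_or_neg {n : ℕ} {α : ℤF} (hα : α ∈ magnusIdeal X n) {w : List X}
    (hw : w.length = n) (hne : magnusCoeff α w ≠ 0) : LeadPos n α ∨ LeadPos n (-α) := by
  obtain ⟨u, ⟨hu, hu0⟩, hmax⟩ := (finite_magnusCoeff n α).exists_maximal ⟨w, hw, hne⟩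
  have hz : ∀ v : List X, v.length = n → u < v → magnusCoeff α v = 0 := fun v hv huv => by
    by_contra h0
    exact absurd (hmax ⟨hv, h0⟩ huv.le) (not_le.2 huv)
  rcases lt_or_gt_of_ne hu0 with h | h
  · refine Or.inr ⟨neg_mem hα, u, hu, ?_, fun v hv huv => ?_⟩
    · rw [magnusCoeff_neg]; exact neg_pos.2 h
    · rw [magnusCoeff_neg, hz v hv huv, neg_zero]
  · exact Or.inl ⟨hα, u, hu, h, hz⟩

theorem not_leadPos_zero (n : ℕ) : ¬ LeadPos n (0 : ℤF) := by
  rintro ⟨-, w, -, h, -⟩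
  rw [magnusCoeff_zero] at h
  exact h.ne rfl

/-- The endomorphism `q` maps each letter `x` to `π x` modulo smaller letters and commutators. -/
structure IsUnitriangular (q : FreeGroup X →* FreeGroup X) (π : X → X) : Prop where
  strictMono : StrictMono π
  diag : ∀ x, magnusCoeff (ofG (q (FreeGroup.of x))) [π x] = 1
  upper : ∀ x y, π x < y → magnusCoeff (ofG (q (FreeGroup.of x))) [y] = 0

/-- Write `α` as a sum of `(y - 1) γ y` and let `x` be the first letter of the leading word. At
words starting with a letter `≥ π x`, terms with `y < x` vanish because `q y` has no such letter in
degree one, and terms with `y > x` vanish because maximality forces `γ y` to have larger order. The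
term `y = x` remains and is handled by induction. -/
theorem IsUnitriangular.magnusCoeff_map {q : FreeGroup X →* FreeGroup X} {π : X → X}
    (hq : IsUnitriangular q π) (w : List X) :
    ∀ {α : ℤF}, α ∈ magnusIdeal X w.length →
      (∀ v : List X, v.length = w.length → w < v → magnusCoeff α v = 0) →
      magnusCoeff (groupRingMap q α) (w.map π) = magnusCoeff α w ∧
      ∀ v : List X, v.length = w.length → w.map π < v → magnusCoeff (groupRingMap q α) v = 0 := by
  induction w with
  | nil =>
    intro α _ _
    constructor
    · obtain ⟨k, s, γ, -, rfl⟩ := exists_fox_decomposition α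
      rw [magnusCoeff_fox_nil, map_add, map_sum, map_zsmul, map_one, magnusCoeff_add,
        magnusCoeff_smul, magnusCoeff_one, magnusCoeff_sum, Finset.sum_eq_zero]
      · simp
      · intro x _
        rw [map_mul, map_sub, map_one, groupRingMap_ofG]
        exact mul_mem_magnusIdeal_succ (n := 0) (ofG_sub_one_mem _) (fun w hw => by simp at hw)
          _ (by simp)
    · intro v hv hlt
      obtain rfl : v = [] := by simpa using hv
      exact absurd hlt (lt_irrefl _)
  | cons x w ih =>
    intro α hα hmax
    obtain ⟨s, γ, hγ, hc, hs, e⟩ := exists_fox_of_mem (n := w.length) hα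
    have hbig : ∀ y, x < y → γ y ∈ magnusIdeal X (w.length + 1) := by
      intro y hy v hv
      rcases Nat.lt_succ_iff_lt_or_eq.1 hv with hv | hv
      · exact hγ y v hv
      · rw [← hc]
        exact hmax _ (by simp [hv]) (List.cons_lt_cons_iff.2 (Or.inl hy))
    have hsame := ih (hγ x) (fun v hv hlt => by
      rw [← hc]
      exact hmax _ (by simp [hv]) (List.cons_lt_cons_iff.2 (Or.inr ⟨rfl, hlt⟩)))
    have hterm : ∀ (y z : X) (v : List X), v.length = w.length →
        magnusCoeff (groupRingMap q ((ofG (FreeGroup.of y) - 1) * γ y)) (z :: v) =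
          magnusCoeff (ofG (q (FreeGroup.of y))) [z] * magnusCoeff (groupRingMap q (γ y)) v := by
      intro y z v hv
      rw [map_mul, map_sub, map_one, groupRingMap_ofG,
        magnusCoeff_mul_cons (ofG_sub_one_mem _) (groupRingMap_mem q (hγ y)) _ _ hv.le,
        magnusCoeff_sub, magnusCoeff_one]
      simp
    have hsum : ∀ (z : X) (v : List X), v.length = w.length → π x ≤ z →
        magnusCoeff (groupRingMap q α) (z :: v) =
          magnusCoeff (ofG (q (FreeGroup.of x))) [z] * magnusCoeff (groupRingMap q (γ x)) v := by
      intro z v hv hz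
      rw [e, map_sum, magnusCoeff_sum, Finset.sum_congr rfl fun y _ => hterm y z v hv]
      refine Finset.sum_eq_single x (fun y _ hyx => ?_) (fun hx => ?_)
      · rcases lt_or_gt_of_ne hyx with h | h
        · rw [hq.upper y z ((hq.strictMono h).trans_le hz), zero_mul]
        · rw [groupRingMap_mem q (hbig y h) v (by omega), mul_zero]
      · rw [hs x hx, map_zero, magnusCoeff_zero, mul_zero]
    constructor
    · rw [List.map_cons, hsum _ _ (by simp) le_rfl, hq.diag, one_mul, hsame.1, hc]
    · intro v hv hlt
      cases v with
      | nil => simp at hv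
      | cons z v =>
        have hv' : v.length = w.length := by simpa using hv
        rw [List.map_cons, List.cons_lt_cons_iff] at hlt
        rcases hlt with h | ⟨rfl, h⟩
        · rw [hsum z v hv' h.le, hq.upper x z h, zero_mul]
        · rw [hsum _ v hv' le_rfl, hsame.2 v hv' h, mul_zero]

theorem IsUnitriangular.leadPos_map {q : FreeGroup X →* FreeGroup X} {π : X → X}
    (hq : IsUnitriangular q π) {n : ℕ} {α : ℤF} (h : LeadPos n α) :
    LeadPos n (groupRingMap q α) := by
  obtain ⟨hα, w, rfl, hpos, hmax⟩ := h
  obtain ⟨h1, h2⟩ := hq.magnusCoeff_map w hα hmax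
  exact ⟨groupRingMap_mem q hα, w.map π, by simp, by rwa [h1], h2⟩

/-- The positive elements of the Magnus order on a free group over a totally ordered alphabet. -/
def MagnusPos (g : FreeGroup X) : Prop := ∃ n, LeadPos n (ofG g - 1)

theorem IsUnitriangular.magnusPos_map {q : FreeGroup X →* FreeGroup X} {π : X → X}
    (hq : IsUnitriangular q π) {g : FreeGroup X} (h : MagnusPos g) : MagnusPos (q g) := by
  obtain ⟨n, hn⟩ := h
  refine ⟨n, ?_⟩
  simpa only [map_sub, map_one, groupRingMap_ofG] using hq.leadPos_map hn

theorem LeadPos.add_of_mem {n : ℕ} {α β : ℤF} (h : LeadPos n α)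
    (hβ : β ∈ magnusIdeal X (n + 1)) : LeadPos n (α + β) :=
  h.congr (add_mem h.1 (magnusIdeal_anti n.le_succ hβ)) fun w hw => by
    rw [magnusCoeff_add, hβ w (by omega), add_zero]

/-- In `a b - 1 = (a - 1) + (b - 1) + (a - 1)(b - 1)` the product has higher order than `b - 1`, and
than `a - 1` if that one leads. Conjugation keeps the leading part and inversion negates it, group
elements having constant term `1`. Totality is Magnus' theorem. -/
theorem isPositiveCone_magnusPos : IsPositiveCone (MagnusPos (X := X)) where
  mul := by
    rintro a b ⟨n, ha⟩ ⟨m, hb⟩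
    have e : ofG (a * b) - 1 = (ofG a - 1) + (ofG b - 1) + (ofG a - 1) * (ofG b - 1) := by
      rw [ofG, map_mul]; noncomm_ring
    have hprod : ∀ k, ofG b - 1 ∈ magnusIdeal X k →
        (ofG a - 1) * (ofG b - 1) ∈ magnusIdeal X (k + 1) := fun k hk =>
      mul_mem_magnusIdeal_succ (ofG_sub_one_mem a) hk
    rcases lt_trichotomy n m with h | rfl | h
    · refine ⟨n, ?_⟩
      rw [e, add_assoc]
      exact ha.add_of_mem (add_mem (magnusIdeal_anti h hb.1)
        (magnusIdeal_anti (by omega) (hprod m hb.1)))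
    · refine ⟨n, ?_⟩
      rw [e]
      exact (ha.add hb).add_of_mem (hprod n hb.1)
    · refine ⟨m, ?_⟩
      rw [e, add_comm (ofG a - 1), add_assoc]
      exact hb.add_of_mem (add_mem (magnusIdeal_anti h ha.1) (hprod m hb.1))
  conj := by
    rintro a g ⟨n, ha⟩
    have e : ofG (g * a * g⁻¹) - 1 = ofG g * (ofG a - 1) * ofG g⁻¹ := by
      have : ofG g * ofG g⁻¹ = 1 := by rw [← map_mul, mul_inv_cancel, map_one]
      rw [ofG, map_mul, map_mul, mul_sub, sub_mul, mul_one, this]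
    have hl : ∀ w : List X, w.length ≤ n →
        magnusCoeff (ofG g * (ofG a - 1)) w = magnusCoeff (ofG a - 1) w := fun w hw => by
      rw [magnusCoeff_mul_left ha.1 w _ hw, magnusCoeff_ofG_nil, one_mul]
    have hlm : ofG g * (ofG a - 1) ∈ magnusIdeal X n := fun w hw => by
      rw [hl w hw.le, ha.1 w hw]
    have hr : ∀ w : List X, w.length ≤ n →
        magnusCoeff (ofG (g * a * g⁻¹) - 1) w = magnusCoeff (ofG a - 1) w := fun w hw => by
      rw [e, magnusCoeff_mul_right _ w hlm hw, magnusCoeff_ofG_nil, mul_one, hl w hw]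
    exact ⟨n, ha.congr (fun w hw => by rw [hr w hw.le, ha.1 w hw]) fun w hw => hr w hw.le⟩
  not_one := by
    rintro ⟨n, h⟩
    rw [ofG, map_one, sub_self] at h
    exact not_leadPos_zero n h
  total := by
    classical
    intro a ha
    have hex : ∃ n, ∃ w : List X, w.length = n ∧ magnusCoeff (ofG a - 1) w ≠ 0 := by
      obtain ⟨w, hw, hne⟩ := exists_magnusCoeff_ne_zero ha
      refine ⟨_, w, rfl, ?_⟩
      rwa [magnusCoeff_sub, magnusCoeff_one, if_neg hw, sub_zero]
    obtain ⟨w, hw, hne⟩ := Nat.find_spec hex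
    have hmem : ofG a - 1 ∈ magnusIdeal X (Nat.find hex) := fun v hv => by
      by_contra h0
      exact Nat.find_min hex hv ⟨v, rfl, h0⟩
    rcases leadPos_or_neg hmem hw hne with h | h
    · exact Or.inl ⟨_, h⟩
    · refine Or.inr ⟨_, h.congr ?_ fun w hw => ?_⟩
      all_goals
        have e : ofG a⁻¹ - 1 = -(ofG a - 1) * ofG a⁻¹ := by
          have : ofG a * ofG a⁻¹ = 1 := by rw [← map_mul, mul_inv_cancel, map_one]
          rw [neg_mul, sub_mul, one_mul, this, neg_sub]
        rw [e]
      · intro v hv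
        rw [magnusCoeff_mul_right _ v h.1 hv.le, h.1 v hv, zero_mul]
      · rw [magnusCoeff_mul_right _ w h.1 hw.le, magnusCoeff_ofG_nil, mul_one]

end MagnusOrder

/-- Used for the acting free groups, where any total order of the letters will do. -/
theorem exists_isPositiveCone_freeGroup (X : Type*) :
    ∃ P : FreeGroup X → Prop, IsPositiveCone P := by
  classical
  let := linearOrderOfSTO (WellOrderingRel (α := X))
  exact ⟨_, isPositiveCone_magnusPos⟩

/-! ### The layered group and its order. -/

section LayeredGroup

/-- The alphabet of countably many layers, indexed by `ℤ × Bool`, each a copy of `H`. -/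
@[ext]
structure Letter (H : Type*) where
  /-- The first coordinate of the layer. -/
  layer : ℤ
  /-- The second coordinate of the layer. -/
  color : Bool
  /-- The position in the layer. -/
  pt : H

/-- Letters are ordered by layer, then by position. -/
@[reducible]
noncomputable def Letter.linearOrder (H : Type*) [LinearOrder H] : LinearOrder (Letter H) :=
  LinearOrder.lift' (fun x : Letter H => toLex (x.layer, toLex (x.color, x.pt))) (by
    rintro ⟨n, c, h⟩ ⟨n', c', h'⟩ e
    simpa using e)

theorem Letter.lt_iff {H : Type*} [LinearOrder H] (x y : Letter H) :
    (Letter.linearOrder H).lt x y ↔ x.layer < y.layer ∨ x.layer = y.layer ∧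
      (x.color < y.color ∨ x.color = y.color ∧ x.pt < y.pt) := by
  change toLex (x.layer, toLex (x.color, x.pt)) < toLex (y.layer, toLex (y.color, y.pt)) ↔ _
  rw [Prod.Lex.toLex_lt_toLex, Prod.Lex.toLex_lt_toLex]

variable {H : Type*} [Group H]

/-- The letter of the next lower layer whose position is multiplied by `x` on the left. -/
def Letter.lower (x : H) (l : Letter H) : Letter H :=
  ⟨if l.color then l.layer else l.layer - 1, !l.color, x * l.pt⟩

/-- Permutations of the alphabet, as automorphisms of the free group. -/
def freeGroupPerm (A : Type*) : Equiv.Perm A →* MulAut (FreeGroup A) where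
  toFun p := FreeGroup.freeGroupCongr p
  map_one' := by ext; simp
  map_mul' p q := by
    apply MulEquiv.ext
    intro x
    simp [FreeGroup.map.comp]

theorem freeGroupPerm_of {A : Type*} (p : Equiv.Perm A) (a : A) :
    freeGroupPerm A p (FreeGroup.of a) = FreeGroup.of (p a) := by
  simp [freeGroupPerm]

/-- Right translation of the positions. -/
def Letter.translate : H →* Equiv.Perm (Letter H) where
  toFun h :=
    { toFun := fun l => ⟨l.layer, l.color, l.pt * h⁻¹⟩
      invFun := fun l => ⟨l.layer, l.color, l.pt * h⟩
      left_inv := fun l => by simp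
      right_inv := fun l => by simp }
  map_one' := by ext <;> simp
  map_mul' g h := by ext <;> simp [mul_assoc]

/-- The shift of the layers. -/
def Letter.shift : Multiplicative ℤ →* Equiv.Perm (Letter H) where
  toFun k :=
    { toFun := fun l => ⟨l.layer + k.toAdd, l.color, l.pt⟩
      invFun := fun l => ⟨l.layer - k.toAdd, l.color, l.pt⟩
      left_inv := fun l => by simp
      right_inv := fun l => by simp }
  map_one' := by ext <;> simp
  map_mul' g h := by ext <;> simp; ring

/-- The automorphism multiplying each letter `l` of color `c` by the letter `l.lower x`. -/
def transvection (c : Bool) (x : H) : MulAut (FreeGroup (Letter H)) :=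
  MonoidHom.toMulEquiv
    (FreeGroup.lift fun l : Letter H => if l.color = c then
      FreeGroup.of l * FreeGroup.of (l.lower x) else FreeGroup.of l)
    (FreeGroup.lift fun l : Letter H => if l.color = c then
      FreeGroup.of l * (FreeGroup.of (l.lower x))⁻¹ else FreeGroup.of l)
    -- The letter `l.lower x` has the other color, so both maps fix it and they undo each other.
    (by
      ext l
      by_cases h : l.color = c <;> simp [h, Letter.lower])
    (by
      ext l
      by_cases h : l.color = c <;> simp [h, Letter.lower])

theorem transvection_of (c : Bool) (x : H) (l : Letter H) :
    transvection c x (FreeGroup.of l) = if l.color = c then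
      FreeGroup.of l * FreeGroup.of (l.lower x) else FreeGroup.of l := by
  simp [transvection]

theorem transvection_inv_of (c : Bool) (x : H) (l : Letter H) :
    (transvection c x)⁻¹ (FreeGroup.of l) = if l.color = c then
      FreeGroup.of l * (FreeGroup.of (l.lower x))⁻¹ else FreeGroup.of l := by
  change (transvection c x).symm (FreeGroup.of l) = _
  simp [transvection]

theorem mulAut_freeGroup_ext {A : Type*} {p q : MulAut (FreeGroup A)}
    (h : ∀ a, p (FreeGroup.of a) = q (FreeGroup.of a)) : p = q := by
  have : p.toMonoidHom = q.toMonoidHom := FreeGroup.ext_hom _ _ fun a => h a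
  exact MulEquiv.toMonoidHom_injective this

/-- Positions are translated on the right but lowered by left multiplication. -/
theorem commute_translate_transvection (h : H) (c : Bool) (x : H) :
    Commute (freeGroupPerm _ (Letter.translate h)) (transvection c x) := by
  refine mulAut_freeGroup_ext fun l => ?_
  rw [MulAut.mul_apply, MulAut.mul_apply, freeGroupPerm_of, transvection_of, transvection_of]
  by_cases hc : l.color = c <;>
    simp [hc, Letter.translate, freeGroupPerm_of, Letter.lower, mul_assoc]

theorem commute_shift_transvection (k : Multiplicative ℤ) (c : Bool) (x : H) :
    Commute (freeGroupPerm _ (Letter.shift k)) (transvection c x) := by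
  refine mulAut_freeGroup_ext fun l => ?_
  rw [MulAut.mul_apply, MulAut.mul_apply, freeGroupPerm_of, transvection_of, transvection_of]
  by_cases hc : l.color = c
  · subst hc
    cases hl : l.color <;> simp [hl, Letter.shift, freeGroupPerm_of, Letter.lower]
    ring_nf
  · simp [hc, Letter.shift, freeGroupPerm_of]

theorem commute_translate_shift (h : H) (k : Multiplicative ℤ) :
    Commute (freeGroupPerm _ (Letter.translate h)) (freeGroupPerm _ (Letter.shift k)) := by
  refine mulAut_freeGroup_ext fun l => ?_
  simp [freeGroupPerm_of, Letter.shift, Letter.translate]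

theorem commute_freeGroup_lift {A G : Type*} [Group G] {f : A → G} {g : G}
    (h : ∀ a, Commute g (f a)) (w : FreeGroup A) : Commute g (FreeGroup.lift f w) := by
  induction w using FreeGroup.induction_on with
  | C1 => simp
  | of a => simpa using h a
  | inv_of a _ => simpa using h a
  | mul u v hu hv => rw [map_mul]; exact hu.mul_right hv

variable {m : ℕ}

/-- The group acting on the layers. -/
abbrev LayerActor (m : ℕ) : Type :=
  (FreeGroup (Fin m) × FreeGroup (Bool × Fin m × Bool)) × Multiplicative ℤ

/-- The action of the transvections belonging to the letters of `F` and their inverses. -/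
def transvectionAction (ε : FreeGroup (Fin m) →* H) :
    FreeGroup (Bool × Fin m × Bool) →* MulAut (FreeGroup (Letter H)) :=
  -- Conjugation by `f` moves the position `1` to `(ε f)⁻¹`, so appending `s` to `f` multiplies the
  -- position on the left by `(ε s)⁻¹`. Inverse letters get their own transvections so that every
  -- word `f` can be built letter by letter.
  FreeGroup.lift fun s => transvection s.1 (ε (FreeGroup.mk [s.2]))⁻¹

theorem commute_translate_transvectionAction (ε : FreeGroup (Fin m) →* H) (f : FreeGroup (Fin m))
    (w : FreeGroup (Bool × Fin m × Bool)) :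
    Commute ((((freeGroupPerm _).comp Letter.translate).comp ε) f) (transvectionAction ε w) :=
  commute_freeGroup_lift (fun _ => commute_translate_transvection _ _ _) w

theorem commute_translate_transvectionAction_shift (ε : FreeGroup (Fin m) →* H)
    (q : FreeGroup (Fin m) × FreeGroup (Bool × Fin m × Bool)) (k : Multiplicative ℤ) :
    Commute (MonoidHom.noncommCoprod (((freeGroupPerm _).comp Letter.translate).comp ε)
      (transvectionAction ε) (commute_translate_transvectionAction ε) q)
      (((freeGroupPerm _).comp Letter.shift) k) := by
  rw [MonoidHom.noncommCoprod_apply]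
  exact (commute_translate_shift _ _).mul_left
    (commute_freeGroup_lift (fun _ => commute_shift_transvection _ _ _) q.2).symm

/-- The action on the free group over all layers. -/
def layerAction (ε : FreeGroup (Fin m) →* H) :
    LayerActor m →* MulAut (FreeGroup (Letter H)) :=
  MonoidHom.noncommCoprod _ _ (commute_translate_transvectionAction_shift ε)

theorem layerAction_apply (ε : FreeGroup (Fin m) →* H) (f : FreeGroup (Fin m))
    (w : FreeGroup (Bool × Fin m × Bool)) (k : Multiplicative ℤ) (a : FreeGroup (Letter H)) :
    layerAction ε ((f, w), k) a = freeGroupPerm _ (Letter.translate (ε f))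
      (transvectionAction ε w (freeGroupPerm _ (Letter.shift k) a)) := rfl

theorem layerAction_shift (ε : FreeGroup (Fin m) →* H) (k : Multiplicative ℤ)
    (a : FreeGroup (Letter H)) :
    layerAction ε (1, k) a = freeGroupPerm _ (Letter.shift k) a :=
  (layerAction_apply ε 1 1 k a).trans (by simp)

/-- The free group over all layers, extended by the group acting on it. -/
abbrev LayeredGroup (ε : FreeGroup (Fin m) →* H) : Type _ :=
  FreeGroup (Letter H) ⋊[layerAction ε] LayerActor m

theorem isUnitriangular_of_map {X : Type*} [LinearOrder X] {q : FreeGroup X →* FreeGroup X}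
    {π : X → X} (hπ : StrictMono π) (hq : ∀ x, q (FreeGroup.of x) = FreeGroup.of (π x)) :
    IsUnitriangular q π where
  strictMono := hπ
  diag x := by rw [hq, magnusCoeff_ofG_of_singleton, if_pos rfl]
  upper x y h := by rw [hq, magnusCoeff_ofG_of_singleton, if_neg h.ne']

/-- Degree-one coefficients add under products, so the extra factor only changes the coefficient at
`y < x`. -/
theorem isUnitriangular_of_mul {X : Type*} [LinearOrder X] {q : FreeGroup X →* FreeGroup X}
    (hq : ∀ x, q (FreeGroup.of x) = FreeGroup.of x ∨ ∃ y < x,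
      q (FreeGroup.of x) = FreeGroup.of x * FreeGroup.of y ∨
      q (FreeGroup.of x) = FreeGroup.of x * (FreeGroup.of y)⁻¹) :
    IsUnitriangular q id := by
  have hinv : ∀ y z : X, z ≠ y → magnusCoeff (ofG (FreeGroup.of y)⁻¹) [z] = 0 := by
    intro y z hzy
    have := magnusCoeff_ofG_mul_singleton (FreeGroup.of y) (FreeGroup.of y)⁻¹ z
    rw [mul_inv_cancel, magnusCoeff_ofG_of_singleton, if_neg hzy, zero_add, ofG, map_one,
      magnusCoeff_one, if_neg (by simp)] at this
    exact this.symm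
  have hval : ∀ x z, x ≤ z → magnusCoeff (ofG (q (FreeGroup.of x))) [z] =
      magnusCoeff (ofG (FreeGroup.of x)) [z] := by
    intro x z hz
    rcases hq x with h | ⟨y, hy, h | h⟩ <;> rw [h]
    · rw [magnusCoeff_ofG_mul_singleton, magnusCoeff_ofG_of_singleton y,
        if_neg (hy.trans_le hz).ne', add_zero]
    · rw [magnusCoeff_ofG_mul_singleton, hinv _ _ (hy.trans_le hz).ne', add_zero]
  refine ⟨strictMono_id, fun x => ?_, fun x y (h : x < y) => ?_⟩
  · exact (hval x x le_rfl).trans (by rw [magnusCoeff_ofG_of_singleton, if_pos rfl])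
  · rw [hval x y h.le, magnusCoeff_ofG_of_singleton, if_neg h.ne']

theorem exists_isPositiveCone_layeredGroup (hH : RightOrderable H)
    (ε : FreeGroup (Fin m) →* H) :
    ∃ P : LayeredGroup ε → Prop, IsPositiveCone P := by
  obtain ⟨o, ho⟩ := hH
  obtain ⟨P₁, hP₁⟩ := exists_isPositiveCone_freeGroup (Fin m)
  obtain ⟨P₂, hP₂⟩ := exists_isPositiveCone_freeGroup (Bool × Fin m × Bool)
  obtain ⟨P₃, hP₃⟩ := hP₁.prod hP₂
  obtain ⟨P₄, hP₄⟩ := hP₃.prod isPositiveCone_int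
  let := Letter.linearOrder H
  -- The layer drops, so the effect of left multiplication on the order of `H` is irrelevant.
  have hlower : ∀ (x : H) (l : Letter H), l.lower x < l := by
    rintro x ⟨n, c, h⟩
    refine (Letter.lt_iff _ _).2 ?_
    cases c <;> simp [Letter.lower]
  have hperm : ∀ p : Equiv.Perm (Letter H), StrictMono p → ∀ a, MagnusPos a →
      MagnusPos (freeGroupPerm _ p a) := fun p hp a ha =>
    (isUnitriangular_of_map (q := (freeGroupPerm _ p).toMonoidHom) hp
      (freeGroupPerm_of p)).magnusPos_map ha
  have htrans : ∀ h : H, StrictMono (Letter.translate h) := by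
    intro h x y hxy
    refine (Letter.lt_iff _ _).2 ?_
    rcases (Letter.lt_iff _ _).1 hxy with h1 | ⟨h1, h2 | ⟨h2, h3⟩⟩
    · exact Or.inl h1
    · exact Or.inr ⟨h1, Or.inl h2⟩
    · exact Or.inr ⟨h1, Or.inr ⟨h2, ho _ _ _ h3⟩⟩
  have hshift : ∀ k, StrictMono (Letter.shift (H := H) k) := by
    intro k x y hxy
    refine (Letter.lt_iff _ _).2 ?_
    rcases (Letter.lt_iff _ _).1 hxy with h1 | ⟨h1, h2⟩
    · exact Or.inl (add_lt_add_left h1 _)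
    · exact Or.inr ⟨congrArg (· + k.toAdd) h1, h2⟩
  have htv : ∀ (w : FreeGroup (Bool × Fin m × Bool)) (a : FreeGroup (Letter H)), MagnusPos a →
      MagnusPos (transvectionAction ε w a) := by
    intro w
    induction w using FreeGroup.induction_on with
    | C1 => intro a ha; simpa using ha
    | of s =>
      intro a ha
      rw [transvectionAction, FreeGroup.lift_apply_of]
      refine (isUnitriangular_of_mul (q := (transvection _ _).toMonoidHom)
        fun l => ?_).magnusPos_map ha
      by_cases h : l.color = s.1
      · exact Or.inr ⟨_, hlower _ l, Or.inl ((transvection_of _ _ l).trans (if_pos h))⟩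
      · exact Or.inl ((transvection_of _ _ l).trans (if_neg h))
    | inv_of s _ =>
      intro a ha
      rw [transvectionAction, map_inv, FreeGroup.lift_apply_of]
      refine (isUnitriangular_of_mul (q := (transvection _ _)⁻¹.toMonoidHom)
        fun l => ?_).magnusPos_map ha
      by_cases h : l.color = s.1
      · exact Or.inr ⟨_, hlower _ l, Or.inr ((transvection_inv_of _ _ l).trans (if_pos h))⟩
      · exact Or.inl ((transvection_inv_of _ _ l).trans (if_neg h))
    | mul u v hu hv =>
      intro a ha
      rw [map_mul, MulAut.mul_apply]
      exact hu _ (hv _ ha)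
  refine ⟨_, isPositiveCone_magnusPos.semidirectProduct hP₄
    fun ⟨⟨f, w⟩, k⟩ a ha => ?_⟩
  rw [layerAction_apply]
  exact hperm _ (htrans _) _ (htv _ _ (hperm _ (hshift _) _ ha))

end LayeredGroup

/-! ### Consequences of the finitely many relations. -/

section Presentation

variable {m : ℕ} {ι : Type*}

/-- Elements of `G` satisfying the defining relations of the layered group, `r` being the relators
of the group acting on the positions. -/
structure LayerRelations (r : ι → FreeGroup (Fin m)) (G : Type*) [Group G] where
  /-- The images of the free group acting on the positions. -/
  p : FreeGroup (Fin m) →* G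
  /-- The transvections. -/
  y : Bool → Fin m × Bool → G
  /-- The shift of the layers. -/
  z : G
  /-- The base letters of the two colors. -/
  t : Bool → G
  commute_p_y : ∀ i c s, Commute (p (FreeGroup.of i)) (y c s)
  commute_p_z : ∀ i, Commute (p (FreeGroup.of i)) z
  commute_y_z : ∀ c s, Commute (y c s) z
  commute_y_t : ∀ c s, Commute (y c s) (t !c)
  y_conj_t : ∀ c s, y c s * t c * (y c s)⁻¹ =
    t c * (p (FreeGroup.mk [s]) * (if c then t false else z⁻¹ * t true * z) *
      (p (FreeGroup.mk [s]))⁻¹)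
  commute_r_t : ∀ j c, Commute (p (r j)) (t c)

namespace LayerRelations

variable {r : ι → FreeGroup (Fin m)} {G : Type*} [Group G] (D : LayerRelations r G)

theorem commute_p_of_forall {g : G} (h : ∀ i, Commute (D.p (FreeGroup.of i)) g)
    (f : FreeGroup (Fin m)) : Commute (D.p f) g := by
  induction f using FreeGroup.induction_on with
  | C1 => simp
  | of a => exact h a
  | inv_of a _ => simpa using h a
  | mul u v hu hv => rw [map_mul]; exact hu.mul_left hv

theorem commute_pf_y (f : FreeGroup (Fin m)) (c : Bool) (s : Fin m × Bool) :
    Commute (D.p f) (D.y c s) := D.commute_p_of_forall (fun i => D.commute_p_y i c s) f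

theorem commute_pf_z (f : FreeGroup (Fin m)) : Commute (D.p f) D.z :=
  D.commute_p_of_forall D.commute_p_z f

theorem commute_conj {g a b : G} (hg : Commute g a) (hb : Commute a b) :
    Commute a (g * b * g⁻¹) :=
  (hg.symm.mul_right hb).mul_right hg.symm.inv_right

/-- The transvections commute with `D.p f`, so the single relation `y_conj_t` holds at every
position; the word `f` grows on the right. -/
theorem y_conj (f : FreeGroup (Fin m)) (c : Bool) (s : Fin m × Bool) :
    D.y c s * (D.p f * D.t c * (D.p f)⁻¹) * (D.y c s)⁻¹ =
      (D.p f * D.t c * (D.p f)⁻¹) * (D.p (f * FreeGroup.mk [s]) *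
        (if c then D.t false else D.z⁻¹ * D.t true * D.z) * (D.p (f * FreeGroup.mk [s]))⁻¹) := by
  have h := (D.commute_pf_y f c s).eq
  have h' := (D.commute_pf_y f c s).inv_inv.eq
  calc _ = D.y c s * D.p f * D.t c * ((D.p f)⁻¹ * (D.y c s)⁻¹) := by group
    _ = D.p f * (D.y c s * D.t c * (D.y c s)⁻¹) * (D.p f)⁻¹ := by rw [← h, h']; group
    _ = _ := by rw [D.y_conj_t, map_mul]; group

/-- With `a` the letter at `f` and `b` the lowered letter at `f * s`, the relator commutes with `a`
and with `y a y⁻¹ = a b`, hence with `b`. -/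
theorem commute_step {f : FreeGroup (Fin m)} {j : ι}
    (h : ∀ c, Commute (D.p (r j)) (D.p f * D.t c * (D.p f)⁻¹)) (s : Fin m × Bool) (c : Bool) :
    Commute (D.p (r j))
      (D.p (f * FreeGroup.mk [s]) * D.t c * (D.p (f * FreeGroup.mk [s]))⁻¹) := by
  have key : ∀ c : Bool, Commute (D.p (r j)) (D.p (f * FreeGroup.mk [s]) *
      (if c then D.t false else D.z⁻¹ * D.t true * D.z) * (D.p (f * FreeGroup.mk [s]))⁻¹) := by
    intro c
    have h1 := commute_conj (D.commute_pf_y (r j) c s).symm (h c)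
    rw [y_conj] at h1
    simpa only [inv_mul_cancel_left] using (h c).inv_right.mul_right h1
  cases c with
  | false => simpa using key true
  | true =>
    -- Lowering a letter of color `false` lands in layer `-1`; conjugation by `z` returns it to
    -- layer `0`.
    have h1 := commute_conj (D.commute_pf_z (r j)).symm (key false)
    have h2 := (D.commute_pf_z (f * FreeGroup.mk [s])).eq
    have h3 := (D.commute_pf_z (f * FreeGroup.mk [s])).inv_inv.eq
    convert h1 using 1
    calc _ = D.p (f * FreeGroup.mk [s]) * D.z * D.z⁻¹ * D.t true * D.z *
          (D.z⁻¹ * (D.p (f * FreeGroup.mk [s]))⁻¹) := by group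
      _ = _ := by rw [h2, ← h3]; simp [mul_assoc]

theorem commute_relator (j : ι) (g : FreeGroup (Fin m)) :
    ∀ c, Commute (D.p (r j)) (D.p g * D.t c * (D.p g)⁻¹) := by
  -- An arbitrary prefix `f` is carried along so that the induction can append the factors of `g`
  -- one after another.
  suffices h : ∀ f : FreeGroup (Fin m),
      (∀ c, Commute (D.p (r j)) (D.p f * D.t c * (D.p f)⁻¹)) →
      ∀ c, Commute (D.p (r j)) (D.p (f * g) * D.t c * (D.p (f * g))⁻¹) by
    simpa using h 1 (by simpa using D.commute_r_t j)
  induction g using FreeGroup.induction_on with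
  | C1 => intro f hf; simpa using hf
  | of a => intro f hf; exact D.commute_step hf (a, true)
  | inv_of a _ => intro f hf; exact D.commute_step hf (a, false)
  | mul u v hu hv => intro f hf; rw [← mul_assoc]; exact hv _ (hu _ hf)

variable {H : Type*} [Group H] {ε : FreeGroup (Fin m) →* H}

/-- Conjugation by `D.p g` permutes the letters at the various positions, so centralizing all of
them passes from the relators to their normal closure. -/
theorem commute_of_mem_ker (hr : Subgroup.normalClosure (Set.range r) = ε.ker)
    {k : FreeGroup (Fin m)} (hk : k ∈ ε.ker) :
    ∀ f c, Commute (D.p k) (D.p f * D.t c * (D.p f)⁻¹) := by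
  rw [← hr] at hk
  have hconj : ∀ g k : FreeGroup (Fin m),
      (∀ f c, Commute (D.p k) (D.p f * D.t c * (D.p f)⁻¹)) →
      ∀ f c, Commute (D.p (g * k * g⁻¹)) (D.p f * D.t c * (D.p f)⁻¹) := by
    intro g k hk f c
    have := (Commute.conj_iff (D.p g)).2 (hk (g⁻¹ * f) c)
    simpa [mul_assoc] using this
  induction hk using Subgroup.closure_induction with
  | mem x hx =>
    obtain ⟨_, ⟨j, rfl⟩, hx⟩ := Group.mem_conjugatesOfSet_iff.1 hx
    obtain ⟨g, rfl⟩ := isConj_iff.1 hx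
    exact hconj g _ (D.commute_relator j)
  | one => simp
  | mul u v _ _ hu hv => intro f c; rw [map_mul]; exact (hu f c).mul_left (hv f c)
  | inv u _ hu => intro f c; rw [map_inv]; exact (hu f c).inv_left

/-- Makes `letter` independent of the chosen preimage. -/
theorem conj_t_eq (hr : Subgroup.normalClosure (Set.range r) = ε.ker)
    {f g : FreeGroup (Fin m)} (h : ε f = ε g) (c : Bool) :
    D.p f * D.t c * (D.p f)⁻¹ = D.p g * D.t c * (D.p g)⁻¹ := by
  have hk : f * g⁻¹ ∈ ε.ker := by rw [MonoidHom.mem_ker, map_mul, map_inv, h, mul_inv_cancel]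
  have := (D.commute_of_mem_ker hr hk g c).eq
  rw [← mul_inv_eq_iff_eq_mul] at this
  rw [← this, map_mul, map_inv]
  group

/-- The element of `G` corresponding to a letter. -/
noncomputable def letter (hε : Function.Surjective ε) (l : Letter H) : G :=
  -- The inverse appears because `Letter.translate` multiplies positions by the inverse.
  D.z ^ l.layer * (D.p (Function.surjInv hε l.pt⁻¹) * D.t l.color *
    (D.p (Function.surjInv hε l.pt⁻¹))⁻¹) * (D.z ^ l.layer)⁻¹

theorem letter_eq (hr : Subgroup.normalClosure (Set.range r) = ε.ker)
    (hε : Function.Surjective ε) (n : ℤ) (c : Bool) {h : H} {f : FreeGroup (Fin m)}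
    (hf : ε f = h⁻¹) :
    D.letter hε ⟨n, c, h⟩ = D.z ^ n * (D.p f * D.t c * (D.p f)⁻¹) * (D.z ^ n)⁻¹ := by
  rw [letter, D.conj_t_eq hr ((Function.surjInv_eq hε _).trans hf.symm)]

theorem letter_translate (hr : Subgroup.normalClosure (Set.range r) = ε.ker)
    (hε : Function.Surjective ε) (f : FreeGroup (Fin m)) (l : Letter H) :
    D.letter hε (Letter.translate (ε f) l) = D.p f * D.letter hε l * (D.p f)⁻¹ := by
  obtain ⟨n, c, h⟩ := l
  obtain ⟨g, hg⟩ := hε h⁻¹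
  rw [D.letter_eq hr hε n c hg]
  refine (D.letter_eq hr hε n c (f := f * g) (by simp [hg])).trans ?_
  have h1 := ((D.commute_pf_z f).zpow_right n).eq
  have h2 := ((D.commute_pf_z f).zpow_right n).inv_inv.eq
  calc _ = D.z ^ n * D.p f * (D.p g * D.t c * (D.p g)⁻¹) * ((D.p f)⁻¹ * (D.z ^ n)⁻¹) := by
        rw [map_mul]; group
    _ = _ := by rw [← h1, h2]; group

theorem letter_shift (hε : Function.Surjective ε) (k : Multiplicative ℤ) (l : Letter H) :
    D.letter hε (Letter.shift k l) =
      D.z ^ k.toAdd * D.letter hε l * (D.z ^ k.toAdd)⁻¹ := by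
  obtain ⟨n, c, h⟩ := l
  simp only [letter, Letter.shift, MonoidHom.coe_mk, OneHom.coe_mk, Equiv.coe_fn_mk]
  rw [add_comm, zpow_add]
  simp only [mul_inv_rev, mul_assoc]

/-- The relations at the base letters reach all letters, because the transvections commute with both
`D.p` and `D.z`. -/
theorem letter_transvection (hr : Subgroup.normalClosure (Set.range r) = ε.ker)
    (hε : Function.Surjective ε) (c : Bool) (s : Fin m × Bool) (l : Letter H) :
    FreeGroup.lift (D.letter hε) (transvection c (ε (FreeGroup.mk [s]))⁻¹ (FreeGroup.of l)) =
      D.y c s * D.letter hε l * (D.y c s)⁻¹ := by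
  obtain ⟨n, c', h⟩ := l
  obtain ⟨g, hg⟩ := hε h⁻¹
  have hz := ((D.commute_y_z c s).zpow_right n).eq
  have hz' := ((D.commute_y_z c s).zpow_right n).inv_inv.eq
  have hmove : ∀ a, D.y c s * (D.z ^ n * a * (D.z ^ n)⁻¹) * (D.y c s)⁻¹ =
      D.z ^ n * (D.y c s * a * (D.y c s)⁻¹) * (D.z ^ n)⁻¹ := by
    intro a
    calc _ = D.y c s * D.z ^ n * a * ((D.z ^ n)⁻¹ * (D.y c s)⁻¹) := by group
      _ = _ := by rw [hz, ← hz']; group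
  rw [transvection_of, D.letter_eq hr hε n c' hg, hmove]
  by_cases hc : c' = c
  · subst hc
    rw [if_pos rfl, map_mul, FreeGroup.lift_apply_of, FreeGroup.lift_apply_of,
      D.letter_eq hr hε n c' hg, D.y_conj]
    have hlow : D.letter hε (Letter.lower (ε (FreeGroup.mk [s]))⁻¹ ⟨n, c', h⟩) =
        D.z ^ n * (D.p (g * FreeGroup.mk [s]) *
          (if c' then D.t false else D.z⁻¹ * D.t true * D.z) *
          (D.p (g * FreeGroup.mk [s]))⁻¹) * (D.z ^ n)⁻¹ := by
      refine (D.letter_eq hr hε _ _ (f := g * FreeGroup.mk [s]) (by simp [hg])).trans ?_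
      cases c' with
      | true => simp
      | false =>
        have h2 := (D.commute_pf_z (g * FreeGroup.mk [s])).inv_right.eq
        have h3 := (D.commute_pf_z (g * FreeGroup.mk [s])).inv_left.eq
        simp only [Bool.false_eq_true, if_false, Bool.not_false]
        rw [← mul_assoc (D.p _), ← mul_assoc (D.p _), h2, mul_assoc _ D.z, ← h3, zpow_sub_one]
        group
    rw [hlow]
    group
  · obtain rfl : c' = !c := by cases c <;> cases c' <;> simp_all
    rw [if_neg hc, FreeGroup.lift_apply_of, D.letter_eq hr hε n _ hg]
    congr 2
    have := (commute_conj (D.commute_pf_y g c s) (D.commute_y_t c s)).eq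
    rw [this, mul_inv_cancel_right]

/-- The action on the letters is implemented by conjugation. -/
noncomputable def actor : LayerActor m →* G :=
  MonoidHom.noncommCoprod
    (MonoidHom.noncommCoprod D.p (FreeGroup.lift fun s => D.y s.1 s.2)
      fun f w => commute_freeGroup_lift (fun s => D.commute_pf_y f s.1 s.2) w)
    (zpowersHom G D.z)
    fun q k => by
      rw [MonoidHom.noncommCoprod_apply, zpowersHom_apply]
      exact (((D.commute_pf_z q.1).zpow_right _).mul_left
        ((commute_freeGroup_lift (fun s => (D.commute_y_z s.1 s.2).symm) q.2).symm.zpow_right _))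

theorem actor_apply (f : FreeGroup (Fin m)) (w : FreeGroup (Bool × Fin m × Bool))
    (k : Multiplicative ℤ) :
    D.actor ((f, w), k) =
      D.p f * FreeGroup.lift (fun s => D.y s.1 s.2) w * D.z ^ k.toAdd := by
  simp [actor, zpowersHom_apply]

/-- This is the compatibility needed to map out of the semidirect product; it is checked on letters
and on generators of the actors. -/
theorem lift_letter_layerAction (hr : Subgroup.normalClosure (Set.range r) = ε.ker)
    (hε : Function.Surjective ε) (q : LayerActor m) (a : FreeGroup (Letter H)) :
    FreeGroup.lift (D.letter hε) (layerAction ε q a) =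
      D.actor q * FreeGroup.lift (D.letter hε) a * (D.actor q)⁻¹ := by
  have hext : ∀ (θ : MulAut (FreeGroup (Letter H))) (g : G),
      (∀ l, FreeGroup.lift (D.letter hε) (θ (FreeGroup.of l)) = g * D.letter hε l * g⁻¹) →
      ∀ a, FreeGroup.lift (D.letter hε) (θ a) = g * FreeGroup.lift (D.letter hε) a * g⁻¹ := by
    intro θ g h a
    have : (FreeGroup.lift (D.letter hε)).comp θ.toMonoidHom =
        (MulAut.conj g).toMonoidHom.comp (FreeGroup.lift (D.letter hε)) :=
      FreeGroup.ext_hom _ _ fun l => by simpa using h l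
    exact DFunLike.congr_fun this a
  have hw : ∀ (w : FreeGroup (Bool × Fin m × Bool)) (a : FreeGroup (Letter H)),
      FreeGroup.lift (D.letter hε) (transvectionAction ε w a) =
        FreeGroup.lift (fun s => D.y s.1 s.2) w * FreeGroup.lift (D.letter hε) a *
          (FreeGroup.lift (fun s => D.y s.1 s.2) w)⁻¹ := by
    intro w
    induction w using FreeGroup.induction_on with
    | C1 => intro a; simp
    | of s =>
      intro a
      rw [transvectionAction, FreeGroup.lift_apply_of, FreeGroup.lift_apply_of]
      exact hext _ _ (D.letter_transvection hr hε s.1 s.2) a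
    | inv_of s ih =>
      intro a
      -- The inverse generator is handled by applying the generator case to the preimage of `a`.
      have := ih ((transvectionAction ε (FreeGroup.of s))⁻¹ a)
      rw [MulAut.apply_inv_self] at this
      rw [map_inv, this]
      simp [mul_assoc]
    | mul u v hu hv =>
      intro a
      rw [map_mul, MulAut.mul_apply, hu, hv, map_mul]
      simp only [mul_inv_rev, mul_assoc]
  obtain ⟨⟨f, w⟩, k⟩ := q
  rw [actor_apply, layerAction_apply, hext _ (D.p f) (fun l => ?_), hw, hext _ (D.z ^ k.toAdd) (fun l => ?_)]
  · simp only [mul_inv_rev, mul_assoc]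
  · rw [freeGroupPerm_of, FreeGroup.lift_apply_of, D.letter_shift]
  · rw [freeGroupPerm_of, FreeGroup.lift_apply_of, D.letter_translate hr]

/-- The homomorphism from the layered group given by elements satisfying the relations. -/
noncomputable def hom (hr : Subgroup.normalClosure (Set.range r) = ε.ker)
    (hε : Function.Surjective ε) : LayeredGroup ε →* G :=
  SemidirectProduct.lift (FreeGroup.lift (D.letter hε)) D.actor fun q =>
    MonoidHom.ext fun a => D.lift_letter_layerAction hr hε q a

end LayerRelations

end Presentation

/-! ### The finite presentation of the layered group, and the embedding. -/

section LayeredPresentation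

open scoped commutatorElement

variable {m : ℕ} {ι : Type*} {H : Type*} [Group H]

/-- The positions, the transvections and the shift inside the layered group. -/
def layeredRelations (ε : FreeGroup (Fin m) →* H) (r : ι → FreeGroup (Fin m))
    (hr : ∀ j, ε (r j) = 1) : LayerRelations r (LayeredGroup ε) where
  p := SemidirectProduct.inr.comp ((MonoidHom.inl _ _).comp (MonoidHom.inl _ _))
  y c s := SemidirectProduct.inr ((1, FreeGroup.of (c, s)), 1)
  z := SemidirectProduct.inr (1, Multiplicative.ofAdd 1)
  t c := SemidirectProduct.inl (FreeGroup.of ⟨0, c, 1⟩)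
  commute_p_y i c s := (show Commute (((FreeGroup.of i, 1), 1) : LayerActor m)
    ((1, FreeGroup.of (c, s)), 1) by simp [commute_iff_eq]).map SemidirectProduct.inr
  commute_p_z i := (show Commute (((FreeGroup.of i, 1), 1) : LayerActor m)
    (1, Multiplicative.ofAdd 1) by simp [commute_iff_eq]).map SemidirectProduct.inr
  commute_y_z c s := (show Commute (((1, FreeGroup.of (c, s)), 1) : LayerActor m)
    (1, Multiplicative.ofAdd 1) by simp [commute_iff_eq]).map SemidirectProduct.inr
  commute_y_t c s := by
    rw [commute_iff_eq, ← mul_inv_eq_iff_eq_mul, ← map_inv, ← SemidirectProduct.inl_aut]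
    simp [layerAction_apply, transvectionAction, transvection_of]
  y_conj_t c s := by
    rw [← map_inv, ← SemidirectProduct.inl_aut]
    have hlow : (if c then SemidirectProduct.inl (FreeGroup.of ⟨0, false, 1⟩)
        else (SemidirectProduct.inr (1, Multiplicative.ofAdd 1))⁻¹ *
          SemidirectProduct.inl (FreeGroup.of ⟨0, true, 1⟩) *
          SemidirectProduct.inr (1, Multiplicative.ofAdd 1) : LayeredGroup ε) =
        SemidirectProduct.inl (FreeGroup.of ⟨if c then 0 else -1, !c, 1⟩) := by
      cases c with
      | true => rfl
      | false =>
        simp only [Bool.false_eq_true, if_false, Bool.not_false]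
        rw [← map_inv, ← SemidirectProduct.inl_aut_inv, ← map_inv]
        simp [layerAction_shift, freeGroupPerm_of, Letter.shift, -map_inv]
    rw [hlow, MonoidHom.comp_apply, ← map_inv, ← SemidirectProduct.inl_aut, ← map_mul]
    simp [layerAction_apply, transvectionAction, transvection_of, freeGroupPerm_of, Letter.translate,
      Letter.lower]
  commute_r_t j c := by
    rw [commute_iff_eq, ← mul_inv_eq_iff_eq_mul, MonoidHom.comp_apply, ← map_inv,
      ← SemidirectProduct.inl_aut]
    simp [layerAction_apply, freeGroupPerm_of, Letter.translate, hr]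

/-- The generators of the layered group: positions, transvections, shift, base letters. -/
abbrev LayerGen (m : ℕ) : Type := Fin m ⊕ (Bool × Fin m × Bool) ⊕ Unit ⊕ Bool

/-- The free group acting on positions inside the free group on the generators. -/
def LayerGen.p (m : ℕ) : FreeGroup (Fin m) →* FreeGroup (LayerGen m) := FreeGroup.map Sum.inl

/-- The generator of a transvection. -/
def LayerGen.y (c : Bool) (s : Fin m × Bool) : FreeGroup (LayerGen m) :=
  FreeGroup.of (Sum.inr (Sum.inl (c, s)))

/-- The generator of the shift. -/
def LayerGen.z (m : ℕ) : FreeGroup (LayerGen m) := FreeGroup.of (Sum.inr (Sum.inr (Sum.inl ())))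

/-- The generator of a base letter. -/
def LayerGen.t (m : ℕ) (c : Bool) : FreeGroup (LayerGen m) :=
  FreeGroup.of (Sum.inr (Sum.inr (Sum.inr c)))

open LayerGen in
/-- The defining relators of the layered group. -/
def layerRelators (r : ι → FreeGroup (Fin m)) : Set (FreeGroup (LayerGen m)) :=
  (Set.range fun x : Fin m × Bool × Fin m × Bool => ⁅p m (FreeGroup.of x.1), y x.2.1 x.2.2⁆) ∪
  (Set.range fun i : Fin m => ⁅p m (FreeGroup.of i), z m⁆) ∪
  (Set.range fun x : Bool × Fin m × Bool => ⁅y x.1 x.2, z m⁆) ∪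
  (Set.range fun x : Bool × Fin m × Bool => ⁅y x.1 x.2, t m !x.1⁆) ∪
  (Set.range fun x : Bool × Fin m × Bool => y x.1 x.2 * t m x.1 * (y x.1 x.2)⁻¹ *
    (t m x.1 * (p m (FreeGroup.mk [x.2]) *
      (if x.1 then t m false else (z m)⁻¹ * t m true * z m) *
      (p m (FreeGroup.mk [x.2]))⁻¹))⁻¹) ∪
  (Set.range fun x : ι × Bool => ⁅p m (r x.1), t m x.2⁆)

theorem layerRelators_finite [Finite ι] (r : ι → FreeGroup (Fin m)) :
    (layerRelators r).Finite := by
  simp only [layerRelators, Set.finite_union, Set.finite_range, and_self]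

/-- The generators of the presented group satisfy the relations. -/
def presentedRelations (r : ι → FreeGroup (Fin m)) :
    LayerRelations r (PresentedGroup (layerRelators r)) where
  p := (PresentedGroup.mk _).comp (LayerGen.p m)
  y c s := PresentedGroup.mk _ (LayerGen.y c s)
  z := PresentedGroup.mk _ (LayerGen.z m)
  t c := PresentedGroup.mk _ (LayerGen.t m c)
  commute_p_y i c s := by
    rw [← commutatorElement_eq_one_iff_commute, MonoidHom.comp_apply, ← map_commutatorElement]
    exact PresentedGroup.one_of_mem
      (Or.inl (Or.inl (Or.inl (Or.inl (Or.inl ⟨(i, c, s), rfl⟩)))))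
  commute_p_z i := by
    rw [← commutatorElement_eq_one_iff_commute, MonoidHom.comp_apply, ← map_commutatorElement]
    exact PresentedGroup.one_of_mem (Or.inl (Or.inl (Or.inl (Or.inl (Or.inr ⟨i, rfl⟩)))))
  commute_y_z c s := by
    rw [← commutatorElement_eq_one_iff_commute, ← map_commutatorElement]
    exact PresentedGroup.one_of_mem (Or.inl (Or.inl (Or.inl (Or.inr ⟨(c, s), rfl⟩))))
  commute_y_t c s := by
    rw [← commutatorElement_eq_one_iff_commute, ← map_commutatorElement]
    exact PresentedGroup.one_of_mem (Or.inl (Or.inl (Or.inr ⟨(c, s), rfl⟩)))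
  y_conj_t c s := by
    have h := PresentedGroup.mk_eq_mk_of_mul_inv_mem (rels := layerRelators r)
      (Or.inl (Or.inr ⟨(c, s), rfl⟩))
    cases c <;> simpa using h
  commute_r_t j c := by
    rw [← commutatorElement_eq_one_iff_commute, MonoidHom.comp_apply, ← map_commutatorElement]
    exact PresentedGroup.one_of_mem (Or.inr ⟨(j, c), rfl⟩)

namespace LayerRelations

variable {r : ι → FreeGroup (Fin m)} {G : Type*} [Group G] (D : LayerRelations r G)

/-- The images of the generators. -/
def gen : LayerGen m → G
  | .inl i => D.p (FreeGroup.of i)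
  | .inr (.inl s) => D.y s.1 s.2
  | .inr (.inr (.inl _)) => D.z
  | .inr (.inr (.inr c)) => D.t c

theorem lift_gen_p (f : FreeGroup (Fin m)) : FreeGroup.lift D.gen (LayerGen.p m f) = D.p f := by
  have : (FreeGroup.lift D.gen).comp (LayerGen.p m) = D.p :=
    FreeGroup.ext_hom _ _ fun i => by simp [LayerGen.p, gen]
  exact DFunLike.congr_fun this f

theorem lift_gen_y (c : Bool) (s : Fin m × Bool) :
    FreeGroup.lift D.gen (LayerGen.y c s) = D.y c s := by
  simp [LayerGen.y, gen]

theorem lift_gen_z : FreeGroup.lift D.gen (LayerGen.z m) = D.z := by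
  simp [LayerGen.z, gen]

theorem lift_gen_t (c : Bool) : FreeGroup.lift D.gen (LayerGen.t m c) = D.t c := by
  simp [LayerGen.t, gen]

theorem lift_gen_relator (w : FreeGroup (LayerGen m)) (hw : w ∈ layerRelators r) :
    FreeGroup.lift D.gen w = 1 := by
  rcases hw with ((((⟨⟨i, c, s⟩, rfl⟩ | ⟨i, rfl⟩) | ⟨⟨c, s⟩, rfl⟩) | ⟨⟨c, s⟩, rfl⟩) |
    ⟨⟨c, s⟩, rfl⟩) | ⟨⟨j, c⟩, rfl⟩ <;> dsimp only
  · rw [map_commutatorElement, lift_gen_p, lift_gen_y, commutatorElement_eq_one_iff_commute]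
    exact D.commute_p_y i c s
  · rw [map_commutatorElement, lift_gen_p, lift_gen_z, commutatorElement_eq_one_iff_commute]
    exact D.commute_p_z i
  · rw [map_commutatorElement, lift_gen_y, lift_gen_z, commutatorElement_eq_one_iff_commute]
    exact D.commute_y_z c s
  · rw [map_commutatorElement, lift_gen_y, lift_gen_t, commutatorElement_eq_one_iff_commute]
    exact D.commute_y_t c s
  · have h := D.y_conj_t c s
    rw [map_mul, map_inv, mul_inv_eq_one]
    cases c <;> simpa [lift_gen_p, lift_gen_y, lift_gen_z, lift_gen_t] using h
  · rw [map_commutatorElement, lift_gen_p, lift_gen_t, commutatorElement_eq_one_iff_commute]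
    exact D.commute_r_t j c

/-- The homomorphism from the presented group given by elements satisfying the relations. -/
def ofPresented : PresentedGroup (layerRelators r) →* G :=
  PresentedGroup.toGroup D.lift_gen_relator

theorem ofPresented_mk (w : FreeGroup (LayerGen m)) :
    D.ofPresented (PresentedGroup.mk _ w) = FreeGroup.lift D.gen w := rfl

end LayerRelations

variable {ε : FreeGroup (Fin m) →* H} {r : ι → FreeGroup (Fin m)}

theorem hom_layeredRelations_t {G : Type*} [Group G] (D : LayerRelations r G)
    (hr : Subgroup.normalClosure (Set.range r) = ε.ker) (hε : Function.Surjective ε) (c : Bool) :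
    D.hom hr hε (SemidirectProduct.inl (FreeGroup.of ⟨0, c, 1⟩)) = D.t c := by
  rw [LayerRelations.hom, SemidirectProduct.lift_inl, FreeGroup.lift_apply_of,
    D.letter_eq hr hε 0 c (f := 1) (by simp)]
  simp

/-- Makes `ofPresented` injective, so that the order pulls back to the presented group. -/
theorem hom_comp_ofPresented (hr : Subgroup.normalClosure (Set.range r) = ε.ker)
    (hε : Function.Surjective ε) (hr' : ∀ j, ε (r j) = 1) :
    ((presentedRelations r).hom hr hε).comp (layeredRelations ε r hr').ofPresented =
      MonoidHom.id _ := by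
  refine PresentedGroup.ext fun x => ?_
  rw [MonoidHom.comp_apply, PresentedGroup.of, LayerRelations.ofPresented_mk,
    FreeGroup.lift_apply_of]
  rcases x with i | s | _ | c
  · refine (SemidirectProduct.lift_inr _ _ _ _).trans
      ((LayerRelations.actor_apply _ _ _ _).trans ?_)
    simp [presentedRelations, LayerGen.p]
  · refine (SemidirectProduct.lift_inr _ _ _ _).trans
      ((LayerRelations.actor_apply _ _ _ _).trans ?_)
    simp [presentedRelations, LayerGen.y]
  · refine (SemidirectProduct.lift_inr _ _ _ _).trans
      ((LayerRelations.actor_apply _ _ _ _).trans ?_)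
    simp [presentedRelations, LayerGen.z]
  · exact hom_layeredRelations_t _ hr hε c

/-- Makes `hom` injective, so that the embedding into the layered group carries over to the
presented group. -/
theorem ofPresented_comp_hom (hr : Subgroup.normalClosure (Set.range r) = ε.ker)
    (hε : Function.Surjective ε) (hr' : ∀ j, ε (r j) = 1) :
    ((layeredRelations ε r hr').ofPresented).comp ((presentedRelations r).hom hr hε) =
      MonoidHom.id _ := by
  have hp : ∀ f, (layeredRelations ε r hr').ofPresented ((presentedRelations r).p f) =
      (layeredRelations ε r hr').p f := LayerRelations.lift_gen_p _
  have hy : ∀ c s, (layeredRelations ε r hr').ofPresented ((presentedRelations r).y c s) =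
      (layeredRelations ε r hr').y c s := LayerRelations.lift_gen_y _
  have hz : (layeredRelations ε r hr').ofPresented (presentedRelations r).z =
      (layeredRelations ε r hr').z := LayerRelations.lift_gen_z _
  have ht : ∀ c, (layeredRelations ε r hr').ofPresented ((presentedRelations r).t c) =
      (layeredRelations ε r hr').t c := LayerRelations.lift_gen_t _
  have hzpow : ∀ n : ℤ, (layeredRelations ε r hr').z ^ n =
      SemidirectProduct.inr (1, Multiplicative.ofAdd n) := by
    intro n
    rw [layeredRelations, ← map_zpow]
    congr 1
    ext <;> simp
  refine SemidirectProduct.hom_ext (FreeGroup.ext_hom _ _ fun l => ?_) ?_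
  · obtain ⟨n, c, h⟩ := l
    obtain ⟨f, hf⟩ := hε h⁻¹
    simp only [MonoidHom.comp_apply, LayerRelations.hom, SemidirectProduct.lift_inl,
      FreeGroup.lift_apply_of, MonoidHom.id_apply]
    rw [LayerRelations.letter_eq _ hr hε n c hf]
    simp only [map_mul, map_inv, map_zpow, hp, hz, ht]
    rw [hzpow]
    simp only [layeredRelations, MonoidHom.comp_apply]
    rw [← map_inv, ← SemidirectProduct.inl_aut, ← map_inv, ← SemidirectProduct.inl_aut]
    simp [layerAction_apply, layerAction_shift, freeGroupPerm_of, Letter.translate, Letter.shift,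
      hf]
  · refine MonoidHom.ext fun q => ?_
    obtain ⟨⟨f, w⟩, k⟩ := q
    simp only [MonoidHom.comp_apply, LayerRelations.hom, SemidirectProduct.lift_inr,
      MonoidHom.id_apply, LayerRelations.actor_apply, map_mul, map_zpow, hp, hz]
    have hw : (layeredRelations ε r hr').ofPresented
        (FreeGroup.lift (fun s : Bool × Fin m × Bool => (presentedRelations r).y s.1 s.2) w) =
        SemidirectProduct.inr ((1, w), 1) := by
      have : ((layeredRelations ε r hr').ofPresented).comp
          (FreeGroup.lift (fun s : Bool × Fin m × Bool => (presentedRelations r).y s.1 s.2)) =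
          SemidirectProduct.inr.comp ((MonoidHom.inl _ _).comp (MonoidHom.inr _ _)) :=
        FreeGroup.ext_hom _ _ fun s => by
          rw [MonoidHom.comp_apply, FreeGroup.lift_apply_of, hy]
          rfl
      exact DFunLike.congr_fun this w
    rw [hw, hzpow]
    simp only [layeredRelations, MonoidHom.comp_apply]
    rw [← map_mul, ← map_mul]
    simp

/-- The kernel of any epimorphism from a free group of finite rank onto a finitely presented group
is the normal closure of finitely many elements. -/
theorem exists_finite_relators [Group.IsFinitelyPresented H] (hε : Function.Surjective ε) :
    ∃ S : Set (FreeGroup (Fin m)), S.Finite ∧ Subgroup.normalClosure S = ε.ker := by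
  obtain ⟨n, φ, hφ, R, hR, hRφ⟩ := Group.IsFinitelyPresented.out (G := H)
  let u : FreeGroup (Fin n) →* FreeGroup (Fin m) :=
    FreeGroup.lift fun i => Function.surjInv hε (φ (FreeGroup.of i))
  let v : FreeGroup (Fin m) →* FreeGroup (Fin n) :=
    FreeGroup.lift fun i => Function.surjInv hφ (ε (FreeGroup.of i))
  have hu : ε.comp u = φ := FreeGroup.ext_hom _ _ fun i => by simp [u, Function.surjInv_eq]
  have hv : φ.comp v = ε := FreeGroup.ext_hom _ _ fun i => by simp [v, Function.surjInv_eq]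
  have hu' : ∀ w, ε (u w) = φ w := DFunLike.congr_fun hu
  have hv' : ∀ w, φ (v w) = ε w := DFunLike.congr_fun hv
  -- A Tietze argument: the old relators rewritten by `u`, together with relators making `u ∘ v` the
  -- identity modulo `S`.
  let S : Set (FreeGroup (Fin m)) :=
    u '' R ∪ Set.range fun i => (FreeGroup.of i)⁻¹ * u (v (FreeGroup.of i))
  refine ⟨S, (hR.image _).union (Set.finite_range _), le_antisymm ?_ ?_⟩
  · refine Subgroup.normalClosure_le_normal ?_
    rintro _ (⟨w, hw, rfl⟩ | ⟨i, rfl⟩)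
    · have : w ∈ φ.ker := hRφ ▸ Subgroup.subset_normalClosure hw
      rw [SetLike.mem_coe, MonoidHom.mem_ker, hu', MonoidHom.mem_ker.1 this]
    · rw [SetLike.mem_coe, MonoidHom.mem_ker, map_mul, map_inv, hu', hv', inv_mul_cancel]
  · intro w hw
    have h1 : ∀ w : FreeGroup (Fin m), QuotientGroup.mk' (Subgroup.normalClosure S) w =
        QuotientGroup.mk' (Subgroup.normalClosure S) (u (v w)) := by
      have : QuotientGroup.mk' (Subgroup.normalClosure S) =
          ((QuotientGroup.mk' (Subgroup.normalClosure S)).comp u).comp v :=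
        FreeGroup.ext_hom _ _ fun i => QuotientGroup.eq.2
          (Subgroup.subset_normalClosure (Or.inr ⟨i, rfl⟩))
      exact DFunLike.congr_fun this
    have h2 : φ.ker ≤ (Subgroup.normalClosure S).comap u := by
      rw [← hRφ]
      exact Subgroup.normalClosure_le_normal fun w hw =>
        Subgroup.subset_normalClosure (Or.inl ⟨w, hw, rfl⟩)
    have h3 : v w ∈ φ.ker := by rw [MonoidHom.mem_ker, hv', MonoidHom.mem_ker.1 hw]
    exact (QuotientGroup.eq_one_iff _).1 ((h1 w).trans ((QuotientGroup.eq_one_iff _).2 (h2 h3)))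

/-- The embedding of the semidirect product into the layer `(0, false)`. -/
def toLayeredGroup (ε : FreeGroup (Fin m) →* H) :
    FreeGroup H ⋊[rightMulAction ε] FreeGroup (Fin m) →* LayeredGroup ε :=
  SemidirectProduct.map (FreeGroup.map fun h => ⟨0, false, h⟩)
    ((MonoidHom.inl _ _).comp (MonoidHom.inl _ _)) fun f =>
      FreeGroup.ext_hom _ _ fun h => by
        simp [rightMulAction, layerAction_apply, freeGroupPerm_of, Letter.translate]

theorem toLayeredGroup_injective (ε : FreeGroup (Fin m) →* H) :
    Function.Injective (toLayeredGroup ε) := by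
  rintro ⟨a, f⟩ ⟨b, g⟩ h
  have h1 : FreeGroup.map (fun h : H => (⟨0, false, h⟩ : Letter H)) a =
      FreeGroup.map (fun h : H => (⟨0, false, h⟩ : Letter H)) b :=
    congrArg SemidirectProduct.left h
  have h2 : (((f, 1), 1) : LayerActor m) = ((g, 1), 1) := congrArg SemidirectProduct.right h
  have h3 : Function.Injective fun h : H => (⟨0, false, h⟩ : Letter H) := fun x y hxy =>
    congrArg Letter.pt hxy
  obtain rfl := FreeGroup.map_injective h3 h1
  obtain rfl : f = g := congrArg (fun q : LayerActor m => q.1.1) h2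
  rfl

end LayeredPresentation

theorem mainTheorem5 {H : Type*} [Group H] [Group.IsFinitelyPresented H]
    (hH : RightOrderable H) (m : ℕ) (ε : FreeGroup (Fin m) →* H)
    (hε : Function.Surjective ε) :
    ∃ (G : Type) (_ : Group G),
      Group.IsFinitelyPresented G ∧ TwoSidedOrderable G ∧
        ∃ j : FreeGroup H ⋊[rightMulAction ε] FreeGroup (Fin m) →* G, Function.Injective j := by
  obtain ⟨S, hS, hSε⟩ := exists_finite_relators hε
  let r : S → FreeGroup (Fin m) := Subtype.val
  have : Finite S := hS
  have hr : Subgroup.normalClosure (Set.range r) = ε.ker := by rw [Subtype.range_coe, hSε]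
  have hr' : ∀ j, ε (r j) = 1 := fun j => by
    rw [← MonoidHom.mem_ker, ← hSε]
    exact Subgroup.subset_normalClosure j.2
  have h1 := DFunLike.congr_fun (hom_comp_ofPresented hr hε hr')
  have h2 := DFunLike.congr_fun (ofPresented_comp_hom hr hε hr')
  obtain ⟨P, hP⟩ := exists_isPositiveCone_layeredGroup hH ε
  have : Finite (layerRelators r) := layerRelators_finite r
  -- The presented group lies in `Type` whatever the universe of `H`, unlike the layered group.
  exact ⟨PresentedGroup (layerRelators r), inferInstance, inferInstance,
    (hP.comap _ (Function.LeftInverse.injective (g := (presentedRelations r).hom hr hε) h1)).twoSidedOrderable,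
    ((presentedRelations r).hom hr hε).comp (toLayeredGroup ε),
    (Function.LeftInverse.injective
      (g := (layeredRelations ε r hr').ofPresented) h2).comp (toLayeredGroup_injective ε)⟩
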